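/- **Theorem (Global Min Cut).** Let $G=(V,E)$ be a simple, unweighted, undirected graph on a known vertex set $V=\{0,\dots,n-1\}$, $n\ge 2$, whose edge set is accessible only through a cut oracle: on a query $S\subseteq V$ the oracle returns the number $c(S)$ of edges between $S$ and $V\setminus S$. A randomized algorithm in this model is an adaptive randomized strategy that in each step queries the oracle, makes an independent random draw, or stops and outputs a set; its cost is the number of queries, and internal computation is free. There is a constant $k$ such that for every $d\in\mathbb N$ there are a constant $C$ and a randomized algorithm with the following properties. For every $n\ge 2$ and every simple graph $G$ on $n$ vertices, 1. the algorithm makes at most $C\,n\,(\log n)^k$ queries (i.e. $\widetilde O(n)$), whatever the outcome of its random draws; and 2. with probability at least $1-n^{-d}$ it outputs a set $S$ with $\emptyset\ne S\ne V$ such that $c(S)=\min\{c(T):\emptyset\ne T\subsetneq V\}$, i.e. an exact global minimum cut of $G$. -/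

import Mathlib

open scoped ENNReal

namespace CutQuery

open Classical in
/-- The value `c(S)` of the cut between `S` and `V ∖ S`: the number of edges of `G` with one endpoint
in `S` and the other one outside `S` (each edge is listed once, as a pair in `S × Sᶜ`). -/
noncomputable def cutValue {V : Type} [Fintype V] (G : SimpleGraph V) (S : Finset V) : ℕ :=
  (G.interedges S Sᶜ).card

/-- `S` is one side of a (global) minimum cut: both sides are nonempty, and no cut with two nonempty
sides has a smaller value. -/
def IsGlobalMinCut {V : Type} [Fintype V] (G : SimpleGraph V) (S : Finset V) : Prop :=
  (S ≠ ∅ ∧ S ≠ Finset.univ) ∧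
    ∀ T : Finset V, T ≠ ∅ → T ≠ Finset.univ → cutValue G S ≤ cutValue G T

/-- Randomized adaptive algorithms with access to a cut oracle on the known vertex set `V`.
An algorithm either stops and outputs a vertex set, or asks the oracle for the value of a cut and
continues depending on the answer, or draws a random number and continues depending on it.
The graph itself is visible only through the answers to the queries. -/
inductive Algorithm (V : Type) : Type
  | output (S : Finset V) : Algorithm V
  | query (S : Finset V) (next : ℕ → Algorithm V) : Algorithm V
  | sample (μ : PMF ℕ) (next : ℕ → Algorithm V) : Algorithm V

/-- The joint distribution of (output, number of oracle queries made) when the algorithm is run with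
the cut oracle of `G`. Every random draw is independent of the earlier ones. -/
noncomputable def Algorithm.run {V : Type} [Fintype V] (G : SimpleGraph V) :
    Algorithm V → PMF (Finset V × ℕ)
  | .output S => PMF.pure (S, 0)
  | .query S next => (run G (next (cutValue G S))).map fun r => (r.1, r.2 + 1)
  | .sample μ next => μ.bind fun i => run G (next i)

end CutQuery

/-! Let `d` be the least degree. If no cut is smaller than `d`, a single vertex is a minimum cut.
Otherwise a minimum cut `T` has fewer than `d` edges, and every vertex has at least `d / 2`
neighbours on its own side, since taking it out of its side must not improve the cut
(`IsGlobalMinCut.leastDegree_le`).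

Random star contraction: make each vertex a centre with probability `1 / q`, where `q` is about `d /
log n`, and contract every other vertex into a random neighbour among the centres. With constant
probability there are `O(n / q)` centres, each vertex sees at least `β = d / (8q)` centres on its
own side, and the pairs (vertex, adjacent centre across `T`) number at most `64 β`. A vertex with `s
≥ β` good and `c` bad choices picks well with probability `s / (s + c) ≥ exp (-c / β)`, so all do
with probability at least `exp (-64)` (`exp_le_card_filter_picks`, `le_card_filter_goodStars`). Then
`T` survives as a union of fibres.

In the contracted graph, cuts below `d` are found from a sparse certificate: a known subgraph `F`
grows by edges found across contracted cuts with fewer than `d` known edges. Such an `F` has fewer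
than `d` edges per fibre, and each edge costs `O(log n)` queries by binary search
(`Solvable.beatsSaturated`). As fibres times `d` is `O(n log n)`, one trial costs `O(n log² n)`;
`O(log n)` independent trials give the error bound. All randomness is drawn first, so the rest is a
family of deterministic query trees. -/

namespace CutQuery

/-! ### Edge counts and cut values. -/

section EdgeCounts

variable {V : Type}

open Classical in
/-- The number of pairs in `A × B` that are adjacent in `G`. -/
noncomputable def edgesBetween (G : SimpleGraph V) (A B : Finset V) : ℕ :=
  ∑ a ∈ A, ∑ b ∈ B, if G.Adj a b then 1 else 0

theorem edgesBetween_comm (G : SimpleGraph V) (A B : Finset V) :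
    edgesBetween G A B = edgesBetween G B A := by
  classical
  unfold edgesBetween
  rw [Finset.sum_comm]
  exact Finset.sum_congr rfl fun b _ => Finset.sum_congr rfl fun a _ =>
    if_congr (G.adj_comm a b) rfl rfl

theorem edgesBetween_union_left [DecidableEq V] (G : SimpleGraph V) {A A' : Finset V}
    (h : Disjoint A A') (B : Finset V) :
    edgesBetween G (A ∪ A') B = edgesBetween G A B + edgesBetween G A' B :=
  Finset.sum_union h

theorem edgesBetween_union_right [DecidableEq V] (G : SimpleGraph V) (A : Finset V)
    {B B' : Finset V} (h : Disjoint B B') :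
    edgesBetween G A (B ∪ B') = edgesBetween G A B + edgesBetween G A B' := by
  rw [edgesBetween_comm, edgesBetween_union_left G h, edgesBetween_comm G B,
    edgesBetween_comm G B']

@[simp] theorem edgesBetween_empty_left (G : SimpleGraph V) (B : Finset V) :
    edgesBetween G ∅ B = 0 := by simp [edgesBetween]

@[simp] theorem edgesBetween_bot (A B : Finset V) :
    edgesBetween (⊥ : SimpleGraph V) A B = 0 := by simp [edgesBetween]

open Classical in
theorem edgesBetween_singleton (G : SimpleGraph V) (a b : V) :
    edgesBetween G {a} {b} = if G.Adj a b then 1 else 0 := by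
  simp only [edgesBetween, Finset.sum_singleton]

theorem edgesBetween_mono {F G : SimpleGraph V} (h : F ≤ G) (A B : Finset V) :
    edgesBetween F A B ≤ edgesBetween G A B := by
  unfold edgesBetween
  refine Finset.sum_le_sum fun a _ => Finset.sum_le_sum fun b _ => ?_
  by_cases hF : F.Adj a b
  · simp [hF, h hF]
  · simp [hF]

theorem edgesBetween_subset (G : SimpleGraph V) {A A' B B' : Finset V} (hA : A ⊆ A')
    (hB : B ⊆ B') : edgesBetween G A B ≤ edgesBetween G A' B' := by
  unfold edgesBetween
  exact (Finset.sum_le_sum fun a _ => Finset.sum_le_sum_of_subset hB).trans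
    (Finset.sum_le_sum_of_subset hA)

theorem edgesBetween_le_of_adj {F G : SimpleGraph V} {A B : Finset V}
    (h : ∀ a ∈ A, ∀ b ∈ B, G.Adj a b → F.Adj a b) : edgesBetween G A B ≤ edgesBetween F A B := by
  unfold edgesBetween
  refine Finset.sum_le_sum fun a ha => Finset.sum_le_sum fun b hb => ?_
  by_cases hG : G.Adj a b
  · simp [hG, h a ha b hb hG]
  · simp [hG]

/-- If `F ≤ G` have equally many edges between `A` and `B`, then they have the same ones. -/
theorem adj_of_edgesBetween_eq {F G : SimpleGraph V} (hFG : F ≤ G) {A B : Finset V}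
    (h : edgesBetween G A B = edgesBetween F A B) {a b : V} (ha : a ∈ A) (hb : b ∈ B)
    (hab : G.Adj a b) : F.Adj a b := by
  classical
  by_contra hF
  refine h.not_gt ?_
  unfold edgesBetween
  have hle : ∀ x y, (if F.Adj x y then 1 else 0) ≤ (if G.Adj x y then 1 else 0) := by
    intro x y
    by_cases hxy : F.Adj x y
    · simp [hxy, hFG hxy]
    · simp [hxy]
  refine Finset.sum_lt_sum (fun x _ => Finset.sum_le_sum fun y _ => hle x y) ⟨a, ha, ?_⟩
  refine Finset.sum_lt_sum (fun y _ => hle a y) ⟨b, hb, ?_⟩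
  simp [hF, hab]

/-- `edgesBetween F X X` sees each edge inside `X` in both orders, hence the 2. -/
theorem edgesBetween_sup_edge_le [DecidableEq V] (F : SimpleGraph V) (u v : V) (X : Finset V) :
    edgesBetween (F ⊔ SimpleGraph.edge u v) X X ≤
      edgesBetween F X X + if u ∈ X ∧ v ∈ X then 2 else 0 := by
  classical
  have key : ∀ (a b : V) (inst : Decidable ((F ⊔ SimpleGraph.edge u v).Adj a b)),
      @ite ℕ _ inst 1 0 ≤
      (if F.Adj a b then 1 else 0) +
        ((if a = u ∧ b = v then 1 else 0) + if a = v ∧ b = u then 1 else 0) := by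
    intro a b inst
    simp only [SimpleGraph.sup_adj, SimpleGraph.edge_adj]
    split_ifs <;> first | omega | (exfalso; tauto)
  have hpair : ∀ p q : V, (∑ a ∈ X, ∑ b ∈ X, if a = p ∧ b = q then 1 else 0) =
      if p ∈ X ∧ q ∈ X then 1 else 0 := by
    intro p q
    have hq : ∀ a, (∑ b ∈ X, if a = p ∧ b = q then 1 else 0) =
        if a = p then (if q ∈ X then 1 else 0) else 0 := by
      intro a
      by_cases ha : a = p <;> simp [ha]
    rw [Finset.sum_congr rfl fun a _ => hq a, Finset.sum_ite_eq', ite_and]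
  unfold edgesBetween
  refine (Finset.sum_le_sum fun a _ => Finset.sum_le_sum fun b _ => key a b _).trans ?_
  simp only [Finset.sum_add_distrib, hpair]
  split_ifs <;> first | omega | (exfalso; tauto)

theorem edgesBetween_lt_sup_edge {F : SimpleGraph V} {u v : V} (huv : u ≠ v) (hF : ¬ F.Adj u v)
    {A B : Finset V} (hu : u ∈ A) (hv : v ∈ B) :
    edgesBetween F A B < edgesBetween (F ⊔ SimpleGraph.edge u v) A B := by
  by_contra hlt
  refine hF (adj_of_edgesBetween_eq (G := F ⊔ SimpleGraph.edge u v) le_sup_left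
    (le_antisymm (not_lt.mp hlt) (edgesBetween_mono le_sup_left A B)) hu hv ?_)
  simp [SimpleGraph.sup_adj, SimpleGraph.edge_adj, huv]

theorem edgesBetween_self_split [DecidableEq V] (G : SimpleGraph V) (X S : Finset V) :
    edgesBetween G X X = edgesBetween G (X ∩ S) (X ∩ S) + edgesBetween G (X \ S) (X \ S) +
      2 * edgesBetween G (X ∩ S) (X \ S) := by
  have h : X = X ∩ S ∪ X \ S := by
    ext x
    simp only [Finset.mem_union, Finset.mem_inter, Finset.mem_sdiff]
    tauto
  have d : Disjoint (X ∩ S) (X \ S) := (Finset.disjoint_sdiff_inter X S).symm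
  conv_lhs => rw [h]
  rw [edgesBetween_union_left G d, edgesBetween_union_right G _ d, edgesBetween_union_right G _ d,
    edgesBetween_comm G (X \ S) (X ∩ S)]
  omega

variable [Fintype V] [DecidableEq V]

theorem cutValue_eq (G : SimpleGraph V) (S : Finset V) :
    cutValue G S = edgesBetween G S Sᶜ := by
  classical
  have h : G.interedges S Sᶜ = (S ×ˢ Sᶜ).filter fun e => G.Adj e.1 e.2 := by
    ext e
    simp [SimpleGraph.mem_interedges_iff, and_assoc]
  have h' : cutValue G S = (G.interedges S Sᶜ).card := by
    unfold cutValue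
    congr!
  rw [h', h, Finset.card_filter, Finset.sum_product]
  unfold edgesBetween
  congr!

theorem cutValue_compl (G : SimpleGraph V) (S : Finset V) : cutValue G Sᶜ = cutValue G S := by
  rw [cutValue_eq, cutValue_eq, compl_compl, edgesBetween_comm]

theorem cutValue_mono {F G : SimpleGraph V} (h : F ≤ G) (S : Finset V) :
    cutValue F S ≤ cutValue G S := by
  rw [cutValue_eq, cutValue_eq]
  exact edgesBetween_mono h _ _

/-- Edges between `A` and `B` are counted in both cuts but do not leave the union. Hence three cut
queries determine `edgesBetween G A B`; the identity also drives the degree argument for minimum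
cuts. -/
theorem cutValue_add_cutValue (G : SimpleGraph V) {A B : Finset V} (h : Disjoint A B) :
    cutValue G A + cutValue G B = cutValue G (A ∪ B) + 2 * edgesBetween G A B := by
  have hA : Aᶜ = B ∪ (A ∪ B)ᶜ := by
    ext x
    have hx : x ∈ A → x ∉ B := fun hx => Finset.disjoint_left.mp h hx
    simp only [Finset.mem_compl, Finset.mem_union]
    tauto
  have hB : Bᶜ = A ∪ (A ∪ B)ᶜ := by
    ext x
    have hx : x ∈ A → x ∉ B := fun hx => Finset.disjoint_left.mp h hx
    simp only [Finset.mem_compl, Finset.mem_union]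
    tauto
  have dA : Disjoint B (A ∪ B)ᶜ :=
    disjoint_compl_right.mono_left Finset.subset_union_right
  have dB : Disjoint A (A ∪ B)ᶜ :=
    disjoint_compl_right.mono_left Finset.subset_union_left
  rw [cutValue_eq, cutValue_eq, cutValue_eq, edgesBetween_union_left G h, hA,
    edgesBetween_union_right G A dA, hB, edgesBetween_union_right G B dB, edgesBetween_comm G B A]
  omega

end EdgeCounts

/-! ### Deterministic query strategies and their composition. -/

section QueryTrees

/-- Deterministic adaptive query strategies that compute a value of type `α`. -/
inductive QueryTree (V α : Type) : Type
  | ret (a : α) : QueryTree V α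
  | ask (S : Finset V) (next : ℕ → QueryTree V α) : QueryTree V α

namespace QueryTree

variable {V α β : Type}

/-- Run a strategy and continue with one that depends on the result. -/
def bind : QueryTree V α → (α → QueryTree V β) → QueryTree V β
  | ret a, f => f a
  | ask S next, f => ask S fun m => (next m).bind f

/-- The strategy, seen as an algorithm that makes no random draw. -/
def toAlgorithm : QueryTree V (Finset V) → Algorithm V
  | ret a => .output a
  | ask S next => .query S fun m => (next m).toAlgorithm

variable [Fintype V]

/-- The value computed on the graph `G`. -/
noncomputable def eval (G : SimpleGraph V) : QueryTree V α → α
  | ret a => a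
  | ask S next => (next (cutValue G S)).eval G

/-- The number of queries made on the graph `G`. -/
noncomputable def cost (G : SimpleGraph V) : QueryTree V α → ℕ
  | ret _ => 0
  | ask S next => (next (cutValue G S)).cost G + 1

theorem eval_bind (G : SimpleGraph V) (t : QueryTree V α) (f : α → QueryTree V β) :
    (t.bind f).eval G = (f (t.eval G)).eval G := by
  induction t with
  | ret a => rfl
  | ask S next ih => exact ih _

theorem cost_bind (G : SimpleGraph V) (t : QueryTree V α) (f : α → QueryTree V β) :
    (t.bind f).cost G = t.cost G + (f (t.eval G)).cost G := by
  induction t with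
  | ret a => simp [bind, cost, eval]
  | ask S next ih =>
    simp only [bind, cost, eval, ih]
    omega

theorem run_toAlgorithm (G : SimpleGraph V) (t : QueryTree V (Finset V)) :
    t.toAlgorithm.run G = PMF.pure (t.eval G, t.cost G) := by
  induction t with
  | ret a => rfl
  | ask S next ih =>
    simp only [toAlgorithm, Algorithm.run, ih, PMF.pure_map, eval, cost]

end QueryTree

variable {V α β ι : Type} [Fintype V]

/-- Some deterministic strategy makes at most `q` queries and always computes a value that is
related by `P` to the graph. -/
def Solvable (q : ℕ) (P : SimpleGraph V → α → Prop) : Prop :=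
  ∃ t : QueryTree V α, ∀ G, t.cost G ≤ q ∧ P G (t.eval G)

namespace Solvable

variable {q q' : ℕ} {P P' : SimpleGraph V → α → Prop} {Q : SimpleGraph V → β → Prop}

theorem ret (q : ℕ) (a : α) (h : ∀ G, P G a) : Solvable q P :=
  ⟨.ret a, fun G => ⟨Nat.zero_le _, h G⟩⟩

theorem mono (h : Solvable q P) (hq : q ≤ q') (hP : ∀ G a, P G a → P' G a) : Solvable q' P' :=
  let ⟨t, ht⟩ := h
  ⟨t, fun G => ⟨(ht G).1.trans hq, hP G _ (ht G).2⟩⟩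

/-- The second task may assume what the first one established. For values that no graph can produce
there is nothing to solve, and an arbitrary result is returned. -/
theorem bind [Nonempty β] (h : Solvable q P)
    (h' : ∀ a, (∃ G, P G a) → Solvable q' fun G b => P G a → Q G b) : Solvable (q + q') Q := by
  obtain ⟨t, ht⟩ := h
  have h'' : ∀ a, Solvable q' fun G b => P G a → Q G b := by
    intro a
    by_cases ha : ∃ G, P G a
    · exact h' a ha
    · exact ret q' (Classical.arbitrary β) fun G hG => (ha ⟨G, hG⟩).elim
  choose f hf using h''
  refine ⟨t.bind f, fun G => ?_⟩
  rw [QueryTree.cost_bind, QueryTree.eval_bind]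
  exact ⟨add_le_add (ht G).1 (hf _ G).1, (hf _ G).2 (ht G).2⟩

theorem map [Nonempty β] (h : Solvable q P) (f : α → β) (hf : ∀ G a, P G a → Q G (f a)) :
    Solvable q Q :=
  (h.bind (q' := 0) (Q := Q) fun a _ => ret 0 (f a) fun G => hf G a).mono le_rfl fun _ _ h => h

theorem query (S : Finset V) : Solvable 1 fun G m => m = cutValue G S :=
  ⟨.ask S .ret, fun _ => ⟨le_rfl, rfl⟩⟩

/-- Independent tasks are solved one after the other. -/
theorem pi [Fintype ι] [Nonempty α] {P : ι → SimpleGraph V → α → Prop}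
    (h : ∀ i, Solvable q (P i)) :
    Solvable (Fintype.card ι * q) fun G (f : ι → α) => ∀ i, P i G (f i) := by
  classical
  have key : ∀ s : Finset ι,
      Solvable (s.card * q) fun G (f : ι → α) => ∀ i ∈ s, P i G (f i) := by
    intro s
    induction s using Finset.induction_on with
    | empty => exact ret _ (Classical.arbitrary _) (by simp)
    | insert i s hi ih =>
      rw [Finset.card_insert_of_notMem hi, add_mul, one_mul]
      refine ih.bind fun f _ => (h i).map (Function.update f i) fun G a ha hf j hj => ?_
      rcases Finset.mem_insert.mp hj with rfl | hj
      · simpa using ha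
      · rw [Function.update_of_ne (ne_of_mem_of_not_mem hj hi)]
        exact hf j hj
  exact (key Finset.univ).mono le_rfl fun G f hf i => hf i (Finset.mem_univ i)

theorem edgesBetween [DecidableEq V] {A B : Finset V} (h : Disjoint A B) :
    Solvable 3 fun G m => m = edgesBetween G A B := by
  refine (query A).bind (q' := 2) fun a _ => (query B).bind (q' := 1) fun b _ =>
    (query (A ∪ B)).map (fun c => (a + b - c) / 2) ?_
  rintro G c rfl rfl rfl
  rw [cutValue_add_cutValue G h]
  omega

/-- A cut of least value in a nonempty family is found by querying all of its members. -/
theorem best (C : Finset (Finset V)) (hC : C.Nonempty) :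
    Solvable C.card fun G S => S ∈ C ∧ ∀ T ∈ C, cutValue G S ≤ cutValue G T := by
  have h := pi (ι := C) (α := ℕ) (q := 1) fun S => query (V := V) S.1
  rw [Fintype.card_coe, mul_one] at h
  have hne : (Finset.univ : Finset C).Nonempty := by
    obtain ⟨S, hS⟩ := hC
    exact ⟨⟨S, hS⟩, Finset.mem_univ _⟩
  refine h.map (fun f => ((Finset.exists_min_image _ f hne).choose : Finset V)) fun G f hf => ?_
  have hmin := (Finset.exists_min_image Finset.univ f hne).choose_spec
  refine ⟨Subtype.coe_prop _, fun T hT => ?_⟩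
  have := hmin.2 ⟨T, hT⟩ (Finset.mem_univ _)
  rwa [hf, hf] at this

/-- Binary search for a place where a property starts to hold. -/
theorem search {P : SimpleGraph V → ℕ → Prop}
    (h : ∀ j, Solvable q fun G (b : Bool) => b = true ↔ P G j) (l a : ℕ) :
    Solvable (l * q) fun G j =>
      ¬ P G a → P G (a + 2 ^ l) → j < a + 2 ^ l ∧ ¬ P G j ∧ P G (j + 1) := by
  induction l generalizing a with
  | zero => exact ret _ a fun G h₁ h₂ => ⟨by simp, h₁, h₂⟩
  | succ l ih =>
    rw [add_mul, one_mul, add_comm]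
    refine (h (a + 2 ^ l)).bind fun b _ => ?_
    cases b with
    | false =>
      refine (ih (a + 2 ^ l)).mono le_rfl fun G j hj hb h₁ h₂ => ?_
      have e : a + 2 ^ l + 2 ^ l = a + 2 ^ (l + 1) := by ring
      rw [e] at hj
      exact hj (fun hP => by simpa using hb.mpr hP) h₂
    | true =>
      refine (ih a).mono le_rfl fun G j hj hb h₁ _ => ?_
      obtain ⟨h₃, h₄⟩ := hj h₁ (hb.mp rfl)
      exact ⟨h₃.trans (by rw [pow_succ]; have := Nat.pos_of_neZero (2 ^ l); omega), h₄⟩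

end Solvable

end QueryTrees

/-! ### Finding vertices and edges by binary search. -/

section FindEdge

variable {n : ℕ}

/-- The elements of `A` that are smaller than `j`. -/
def below (A : Finset (Fin n)) (j : ℕ) : Finset (Fin n) := A.filter fun v => (v : ℕ) < j

theorem below_subset (A : Finset (Fin n)) (j : ℕ) : below A j ⊆ A := Finset.filter_subset _ _

theorem below_zero (A : Finset (Fin n)) : below A 0 = ∅ := by simp [below]

theorem below_of_le (A : Finset (Fin n)) {j : ℕ} (h : n ≤ j) : below A j = A :=
  Finset.filter_true_of_mem fun v _ => v.2.trans_le h

theorem below_succ {A : Finset (Fin n)} {w : Fin n} (hw : w ∈ A) :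
    below A ((w : ℕ) + 1) = below A w ∪ {w} := by
  ext v
  simp only [below, Finset.mem_filter, Finset.mem_union, Finset.mem_singleton, Fin.ext_iff]
  constructor
  · rintro ⟨h, h'⟩
    rcases Nat.lt_succ_iff_lt_or_eq.mp h' with h'' | h''
    · exact Or.inl ⟨h, h''⟩
    · exact Or.inr h''
  · rintro (⟨h, h'⟩ | h)
    · exact ⟨h, by omega⟩
    · exact ⟨by rwa [Fin.ext h], by omega⟩

theorem below_succ_of_notMem {A : Finset (Fin n)} {j : ℕ} (h : ∀ w ∈ A, (w : ℕ) ≠ j) :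
    below A (j + 1) = below A j := by
  refine Finset.filter_congr fun v hv => ?_
  have := h v hv
  omega

theorem edgesBetween_below_succ (G : SimpleGraph (Fin n)) {A : Finset (Fin n)} {w : Fin n}
    (hw : w ∈ A) (B : Finset (Fin n)) : edgesBetween G (below A ((w : ℕ) + 1)) B =
      edgesBetween G (below A w) B + edgesBetween G {w} B := by
  rw [below_succ hw, edgesBetween_union_left]
  simp [below]

/-- The place where the number of edges from an initial part of `A` to `B` starts to exceed a
threshold is found by binary search. -/
theorem Solvable.findVertex [NeZero n] {l : ℕ} (hn : n ≤ 2 ^ l) {A B : Finset (Fin n)}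
    (hAB : Disjoint A B) {thr : ℕ → ℕ} (hthr : Monotone thr) :
    Solvable (l * 3) fun G (w : Fin n) => thr (2 ^ l) < CutQuery.edgesBetween G A B →
      w ∈ A ∧ CutQuery.edgesBetween G (below A w) B ≤ thr w ∧
        thr (w + 1) < CutQuery.edgesBetween G (below A w) B + CutQuery.edgesBetween G {w} B := by
  have htest : ∀ j, Solvable 3 fun G (b : Bool) =>
      b = true ↔ thr j < CutQuery.edgesBetween G (below A j) B := fun j =>
    (Solvable.edgesBetween (hAB.mono_left (below_subset A j))).map (fun m => decide (thr j < m))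
      fun G m hm => by rw [decide_eq_true_iff, hm]
  refine (Solvable.search htest l 0).map (fun j => Fin.ofNat n j) fun G j hj hlt => ?_
  rw [below_zero, edgesBetween_empty_left, zero_add, below_of_le A hn] at hj
  obtain ⟨_, h₁, h₂⟩ := hj (by simp) hlt
  -- If `j` is not in `A`, the prefix does not change from `j` to `j + 1` while the threshold does
  -- not drop, so it could not be crossed there.
  by_cases h : ∀ w ∈ A, (w : ℕ) ≠ j
  · rw [below_succ_of_notMem h] at h₂
    exact absurd (h₂.trans_le' (hthr j.le_succ)) h₁
  · push Not at h
    obtain ⟨w, hw, rfl⟩ := h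
    rw [edgesBetween_below_succ G hw] at h₂
    simp only [Fin.ofNat_eq_cast, Fin.cast_val_eq_self]
    exact ⟨hw, not_lt.mp h₁, h₂⟩

theorem monotone_edgesBetween_below (F : SimpleGraph (Fin n)) (A B : Finset (Fin n)) :
    Monotone fun j => edgesBetween F (below A j) B := fun i j hij =>
  edgesBetween_subset F (fun v hv => by
    rw [below, Finset.mem_filter] at hv ⊢
    exact ⟨hv.1, hv.2.trans_le hij⟩) subset_rfl

/-- The threshold is the count for `F` on the same prefix: where the count for `G` first overtakes
it, the increment at `w` is larger in `G` than in `F`. -/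
theorem Solvable.findVertex_of_lt [NeZero n] {l : ℕ} (hn : n ≤ 2 ^ l) {A B : Finset (Fin n)}
    (hAB : Disjoint A B) (F : SimpleGraph (Fin n)) :
    Solvable (l * 3) fun G (w : Fin n) =>
      CutQuery.edgesBetween F A B < CutQuery.edgesBetween G A B →
        w ∈ A ∧ CutQuery.edgesBetween F {w} B < CutQuery.edgesBetween G {w} B := by
  refine (Solvable.findVertex hn hAB (monotone_edgesBetween_below F A B)).mono le_rfl
    fun G w hw hlt => ?_
  rw [below_of_le A hn] at hw
  obtain ⟨h, h₁, h₂⟩ := hw hlt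
  refine ⟨h, ?_⟩
  simp only [edgesBetween_below_succ F h] at h₂
  omega

/-- An edge between `A` and `B` that is not in the known graph `F` is found with logarithmically
many queries. -/
theorem Solvable.findEdge [NeZero n] {l : ℕ} (hn : n ≤ 2 ^ l) {A B : Finset (Fin n)}
    (hAB : Disjoint A B) (F : SimpleGraph (Fin n)) :
    Solvable (6 * l) fun G (p : Fin n × Fin n) =>
      F ≤ G → CutQuery.edgesBetween F A B < CutQuery.edgesBetween G A B →
        p.1 ∈ A ∧ p.2 ∈ B ∧ G.Adj p.1 p.2 ∧ ¬ F.Adj p.1 p.2 := by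
  refine ((Solvable.findVertex_of_lt hn hAB F).bind (q' := l * 3) (Q := fun G p => F ≤ G →
    CutQuery.edgesBetween F A B < CutQuery.edgesBetween G A B →
      p.1 ∈ A ∧ p.2 ∈ B ∧ G.Adj p.1 p.2 ∧ ¬ F.Adj p.1 p.2) fun u _ => ?_).mono (by omega)
      fun _ _ h => h
  by_cases hu : u ∈ A
  · have hd : Disjoint B {u} := by
      rw [Finset.disjoint_singleton_right]
      exact Finset.disjoint_left.mp hAB hu
    refine (Solvable.findVertex_of_lt hn hd F).map (fun v => (u, v)) fun G v hv hu hFG hlt => ?_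
    obtain ⟨hu, hlt'⟩ := hu hlt
    rw [edgesBetween_comm F, edgesBetween_comm G] at hlt'
    obtain ⟨hv, hlt''⟩ := hv hlt'
    rw [edgesBetween_singleton, edgesBetween_singleton] at hlt''
    refine ⟨hu, hv, ?_⟩
    rw [G.adj_comm, F.adj_comm]
    split_ifs at hlt'' with h₁ h₂ <;> first | omega | exact ⟨‹_›, ‹_›⟩
  · exact Solvable.ret _ (u, u) fun G h _ hlt => absurd (h hlt).1 hu

/-- One query either certifies that `F` already contains all edges across `S`, or shows that a new
one exists and can be searched for. -/
theorem Solvable.findCutEdge [NeZero n] {l : ℕ} (hn : n ≤ 2 ^ l) (F : SimpleGraph (Fin n))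
    (S : Finset (Fin n)) :
    Solvable (1 + 6 * l) fun G (o : Option (Fin n × Fin n)) => F ≤ G →
      (o = none → cutValue G S = cutValue F S) ∧
        ∀ p, o = some p → p.1 ∈ S ∧ p.2 ∉ S ∧ G.Adj p.1 p.2 ∧ ¬ F.Adj p.1 p.2 := by
  refine (Solvable.query S).bind fun m _ => ?_
  by_cases hm : m = cutValue F S
  · refine Solvable.ret _ none ?_
    rintro G h -
    exact ⟨fun _ => h ▸ hm, by simp⟩
  · refine (Solvable.findEdge hn (disjoint_compl_right (a := S)) F).map some ?_
    rintro G p hp rfl hFG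
    have hlt : cutValue F S < cutValue G S :=
      lt_of_le_of_ne (cutValue_mono hFG S) (Ne.symm hm)
    rw [cutValue_eq, cutValue_eq] at hlt
    obtain ⟨h₁, h₂, h₃, h₄⟩ := hp hFG hlt
    refine ⟨by simp, ?_⟩
    rintro _ ⟨⟩
    exact ⟨h₁, Finset.mem_compl.mp h₂, h₃, h₄⟩

end FindEdge

/-! ### Sparse certificates for small cuts of a contracted graph. -/

section Certificate

variable {V W : Type}

/-- `S` is a union of fibres of `r`. -/
def Saturated (r : V → W) (S : Finset V) : Prop := ∀ u v, r u = r v → (u ∈ S ↔ v ∈ S)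

theorem Saturated.inter [DecidableEq V] {r : V → W} {S T : Finset V} (hS : Saturated r S)
    (hT : Saturated r T) : Saturated r (S ∩ T) := fun u v h => by
  rw [Finset.mem_inter, Finset.mem_inter, hS u v h, hT u v h]

theorem Saturated.sdiff [DecidableEq V] {r : V → W} {S T : Finset V} (hS : Saturated r S)
    (hT : Saturated r T) : Saturated r (S \ T) := fun u v h => by
  rw [Finset.mem_sdiff, Finset.mem_sdiff, hS u v h, hT u v h]

theorem Saturated.card_image [DecidableEq V] [DecidableEq W] {r : V → W} {S : Finset V}
    (hS : Saturated r S) (X : Finset V) :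
    (X.image r).card = ((X ∩ S).image r).card + ((X \ S).image r).card := by
  rw [← Finset.card_union_of_disjoint, ← Finset.image_union]
  · congr 2
    ext x
    simp only [Finset.mem_union, Finset.mem_inter, Finset.mem_sdiff]
    tauto
  · rw [Finset.disjoint_left]
    intro w h₁ h₂
    obtain ⟨u, hu, rfl⟩ := Finset.mem_image.mp h₁
    obtain ⟨v, hv, h⟩ := Finset.mem_image.mp h₂
    rw [Finset.mem_inter] at hu
    rw [Finset.mem_sdiff] at hv
    exact hv.2 ((hS v u h).mpr hu.2)

/-- The sparsity of a graph, all of whose edges were added across cuts with fewer than `k` edges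
that are unions of fibres of `r`. -/
def Sparse [DecidableEq W] (r : V → W) (k : ℕ) (F : SimpleGraph V) : Prop :=
  ∀ X : Finset V, Saturated r X → X.Nonempty →
    edgesBetween F X X + 2 * k ≤ 2 * k * (X.image r).card

theorem sparse_bot [DecidableEq W] (r : V → W) (k : ℕ) : Sparse r k ⊥ := by
  intro X _ hX
  rw [edgesBetween_bot, zero_add]
  exact Nat.le_mul_of_pos_right _ (hX.image r).card_pos

/-- If `X` contains both ends, split it along `S`. Both parts satisfy the bound, and at most `k - 1`
old edges plus the new one run between them, so one of the two saved terms `2 * k` pays for these.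
-/
theorem Sparse.sup_edge [Fintype V] [DecidableEq V] [DecidableEq W] {r : V → W} {k : ℕ}
    {F : SimpleGraph V} (hF : Sparse r k F) {S : Finset V} (hS : Saturated r S)
    (hk : cutValue F S < k) {u v : V} (hu : u ∈ S) (hv : v ∉ S) :
    Sparse r k (F ⊔ SimpleGraph.edge u v) := by
  intro X hX hne
  have hle := edgesBetween_sup_edge_le F u v X
  by_cases huv : u ∈ X ∧ v ∈ X
  · rw [if_pos huv] at hle
    have h₁ := hF (X ∩ S) (hX.inter hS) ⟨u, Finset.mem_inter.mpr ⟨huv.1, hu⟩⟩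
    have h₂ := hF (X \ S) (hX.sdiff hS) ⟨v, Finset.mem_sdiff.mpr ⟨huv.2, hv⟩⟩
    have h₃ := edgesBetween_self_split F X S
    have h₄ : edgesBetween F (X ∩ S) (X \ S) ≤ cutValue F S := by
      rw [cutValue_eq]
      refine edgesBetween_subset F Finset.inter_subset_right fun x hx => ?_
      exact Finset.mem_compl.mpr (Finset.mem_sdiff.mp hx).2
    rw [hS.card_image X, mul_add]
    omega
  · rw [if_neg huv] at hle
    have := hF X hX hne
    omega

/-- The new label records the old one together with membership in `S`, so the class that contains
`u` and `v` is split and no classes merge. -/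
theorem card_image_refine [Fintype V] [DecidableEq V] (lab : V → ℕ) (S : Finset V) {u v : V}
    (huv : lab u = lab v) (hu : u ∈ S) (hv : v ∉ S) :
    (Finset.univ.image lab).card <
      (Finset.univ.image fun x => 2 * lab x + if x ∈ S then 1 else 0).card := by
  have h : Finset.univ.image lab =
      (Finset.univ.image fun x => 2 * lab x + if x ∈ S then 1 else 0).image (· / 2) := by
    rw [Finset.image_image]
    refine Finset.image_congr fun x _ => ?_
    simp only [Function.comp]
    split_ifs <;> omega
  rw [h]
  refine lt_of_le_of_ne Finset.card_image_le fun heq => ?_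
  have hinj := Finset.card_image_iff.mp heq
  have := hinj (Finset.mem_coe.mpr (Finset.mem_image_of_mem _ (Finset.mem_univ u)))
    (Finset.mem_coe.mpr (Finset.mem_image_of_mem _ (Finset.mem_univ v)))
    (by simp only [hu, hv, if_true, if_false]; omega)
  simp only [hu, hv, if_true, if_false] at this
  omega

theorem card_image_le_of_factors [Fintype V] [DecidableEq W] {r : V → W} {lab : V → ℕ}
    (h : ∀ u v, r u = r v → lab u = lab v) :
    (Finset.univ.image lab).card ≤ (Finset.univ.image r).card := by
  obtain ⟨e, rfl⟩ := (Function.factorsThrough_iff lab).mp fun u v huv => h u v huv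
  rw [← Finset.image_image]
  exact Finset.card_image_le

/-- `S` is at most as large a cut as any `r`-saturated cut with fewer than `k` edges. -/
def BeatsSaturated [Fintype V] (r : V → W) (k : ℕ) (G : SimpleGraph V) (S : Finset V) : Prop :=
  ∀ T : Finset V, Saturated r T → T ≠ ∅ → T ≠ Finset.univ → cutValue G T < k →
    S ≠ ∅ ∧ S ≠ Finset.univ ∧ cutValue G S ≤ cutValue G T

/-- Take a saturated `S` that is smallest in `F`. If `cutValue G T < k`, then `S` has fewer than `k`
edges in `F` too, so its `F`-value is its true value, and it is at most the value of `T`. -/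
theorem exists_beatsSaturated [Fintype V] [DecidableEq V] (r : V → W) (k : ℕ)
    (F : SimpleGraph V) :
    ∃ S : Finset V, ∀ G : SimpleGraph V, F ≤ G → (∀ S, Saturated r S → cutValue F S < k →
      cutValue G S = cutValue F S) → BeatsSaturated r k G S := by
  classical
  let C : Finset (Finset V) :=
    Finset.univ.filter fun S => Saturated r S ∧ S ≠ ∅ ∧ S ≠ Finset.univ
  by_cases hC : C.Nonempty
  · obtain ⟨S, hS, hmin⟩ := Finset.exists_min_image C (cutValue F) hC
    obtain ⟨hS₁, hS₂, hS₃⟩ := (Finset.mem_filter.mp hS).2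
    refine ⟨S, fun G hFG hG T hT hT₁ hT₂ hTk => ⟨hS₂, hS₃, ?_⟩⟩
    have h₁ := hmin T (Finset.mem_filter.mpr ⟨Finset.mem_univ _, hT, hT₁, hT₂⟩)
    have h₂ := cutValue_mono hFG T
    rw [hG S hS₁ (by omega)]
    exact h₁.trans h₂
  · refine ⟨∅, fun G _ _ T hT hT₁ hT₂ _ => ?_⟩
    exact (hC ⟨T, Finset.mem_filter.mpr ⟨Finset.mem_univ _, hT, hT₁, hT₂⟩⟩).elim

variable {n : ℕ}

/-- The labels encode what is known to be complete: an unknown edge between different fibres has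
equally labelled ends. Each round adds an edge to `F` or splits a label class. Sparsity bounds the
edges and the number of fibres bounds the classes, so `m` bounds the remaining rounds. -/
theorem Solvable.beatsSaturated_aux [NeZero n] [DecidableEq W] {l : ℕ} (hn : n ≤ 2 ^ l)
    (r : Fin n → W) (k m : ℕ) (F : SimpleGraph (Fin n)) (lab : Fin n → ℕ) (hF : Sparse r k F)
    (hlab : ∀ u v, r u = r v → lab u = lab v)
    (hm : 2 * (k + 1) * (Finset.univ.image r).card <
      CutQuery.edgesBetween F Finset.univ Finset.univ + 2 * (Finset.univ.image lab).card + m) :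
    Solvable (m * (1 + 6 * l)) fun G S => F ≤ G →
      (∀ u v, G.Adj u v → ¬ F.Adj u v → r u ≠ r v → lab u = lab v) → BeatsSaturated r k G S := by
  induction m generalizing F lab with
  | zero =>
    -- An exhausted budget is impossible: the potential would exceed what sparsity and the number of
    -- fibres allow.
    have h₁ := hF Finset.univ (fun _ _ _ => by simp) Finset.univ_nonempty
    have h₂ := card_image_le_of_factors hlab
    rw [mul_add, add_mul] at hm
    omega
  | succ m ih =>
    -- A useful query is a saturated cut, small in `F`, across which an unknown edge is not yet
    -- excluded.
    by_cases hS : ∃ S, Saturated r S ∧ cutValue F S < k ∧ ∃ u v, lab u = lab v ∧ u ∈ S ∧ v ∉ S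
    · obtain ⟨S, hS, hSk, u, v, huv, hu, hv⟩ := hS
      rw [add_mul, one_mul, add_comm]
      refine (Solvable.findCutEdge hn F S).bind fun o _ => ?_
      rcases o with _ | ⟨a, b⟩
      · refine (ih F (fun x => 2 * lab x + if x ∈ S then 1 else 0) hF
          (fun x y hxy => by simp only [hlab x y hxy, hS x y hxy]) ?_).mono le_rfl
          fun G T hT hG hFG hGF => hT hFG ?_
        · have := card_image_refine lab S huv hu hv
          omega
        · intro x y hxy hFxy hr
          have heq := (hG hFG).1 rfl
          rw [cutValue_eq, cutValue_eq] at heq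
          have hx : x ∈ S → y ∈ S := fun hx => by
            by_contra hy
            exact hFxy (adj_of_edgesBetween_eq hFG heq hx (Finset.mem_compl.mpr hy) hxy)
          have hy : y ∈ S → x ∈ S := fun hy => by
            by_contra hx
            exact hFxy (adj_of_edgesBetween_eq hFG heq hy (Finset.mem_compl.mpr hx) hxy.symm).symm
          have hxy' : x ∈ S ↔ y ∈ S := ⟨hx, hy⟩
          simp only [hGF x y hxy hFxy hr, hxy']
      · by_cases hab : a ∈ S ∧ b ∉ S ∧ ¬ F.Adj a b
        · obtain ⟨ha, hb, hab⟩ := hab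
          have hne : a ≠ b := fun h => hb (h ▸ ha)
          refine (ih (F ⊔ SimpleGraph.edge a b) lab (hF.sup_edge hS hSk ha hb) hlab ?_).mono le_rfl
            fun G T hT hG hFG hGF => hT (sup_le hFG ?_) ?_
          · have := edgesBetween_lt_sup_edge hne hab (Finset.mem_univ a) (Finset.mem_univ b)
            omega
          · rw [SimpleGraph.edge_le_iff]
            exact Or.inr ((hG hFG).2 _ rfl).2.2.1
          · intro x y hxy hFxy hr
            exact hGF x y hxy (fun h => hFxy (Or.inl h)) hr
        -- Such an answer cannot come from a graph that contains `F`, so the output does not matter.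
        · refine Solvable.ret _ ∅ fun G hG hFG => ?_
          obtain ⟨h₁, h₂, -, h₃⟩ := (hG hFG).2 _ rfl
          exact (hab ⟨h₁, h₂, h₃⟩).elim
    -- Now every saturated cut that is small in `F` is a union of label classes. No unknown edge
    -- crosses it, so its value in `F` is exact.
    · push Not at hS
      obtain ⟨S, hbeat⟩ := exists_beatsSaturated r k F
      refine Solvable.ret _ S fun G hFG hGF => hbeat G hFG fun T hT hTk => ?_
      refine le_antisymm ?_ (cutValue_mono hFG T)
      rw [cutValue_eq, cutValue_eq]
      refine edgesBetween_le_of_adj fun a ha b hb hab => ?_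
      rw [Finset.mem_compl] at hb
      by_contra hFab
      exact hb (hS T hT hTk a b (hGF a b hab hFab fun h => hb ((hT a b h).mp ha)) ha)

/-- The best cut that is a union of fibres of `r` and has fewer than `k` edges is found with about
`k` queries per fibre. -/
theorem Solvable.beatsSaturated [NeZero n] [DecidableEq W] {l : ℕ} (hn : n ≤ 2 ^ l)
    (r : Fin n → W) (k : ℕ) :
    Solvable (2 * (k + 1) * (Finset.univ.image r).card * (1 + 6 * l))
      (BeatsSaturated (V := Fin n) r k) := by
  refine (Solvable.beatsSaturated_aux hn r k _ ⊥ (fun _ => 0) (sparse_bot r k)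
    (fun _ _ _ => rfl) ?_).mono le_rfl fun G S hS => hS bot_le fun _ _ _ _ _ => rfl
  have : (Finset.univ.image fun _ : Fin n => 0).card = 1 := by
    rw [Finset.image_const Finset.univ_nonempty, Finset.card_singleton]
  omega

end Certificate

/-! ### Star contraction and the algorithm for fixed random draws. -/

section Stars

variable {n : ℕ}

open Classical in
/-- The neighbours of `v` in `R`. -/
noncomputable def nbrsIn {V : Type} (G : SimpleGraph V) (R : Finset V) (v : V) : Finset V :=
  R.filter (G.Adj v)

theorem mem_nbrsIn {V : Type} {G : SimpleGraph V} {R : Finset V} {v w : V} :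
    w ∈ nbrsIn G R v ↔ w ∈ R ∧ G.Adj v w := by
  simp [nbrsIn]

theorem edgesBetween_eq_card_nbrsIn {V : Type} (G : SimpleGraph V) (R : Finset V) (v : V) :
    edgesBetween G R {v} = (nbrsIn G R v).card := by
  classical
  rw [edgesBetween_comm, nbrsIn, Finset.card_filter, edgesBetween, Finset.sum_singleton]

theorem nbrsIn_below (G : SimpleGraph (Fin n)) (R : Finset (Fin n)) (v : Fin n) (j : ℕ) :
    nbrsIn G (below R j) v = below (nbrsIn G R v) j := by
  ext w
  simp only [mem_nbrsIn, below, Finset.mem_filter]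
  tauto

/-- `r` fixes the centres in `R` and sends any other vertex `v` with a neighbour in `R` to the
neighbour whose position is prescribed by `x v`. -/
def IsStarMap (G : SimpleGraph (Fin n)) (R : Finset (Fin n)) (x : Fin n → ℕ)
    (r : Fin n → Fin n) : Prop :=
  ∀ v, (v ∈ R → r v = v) ∧ (v ∉ R → (nbrsIn G R v).Nonempty → r v ∈ nbrsIn G R v ∧
    (below (nbrsIn G R v) (r v)).card = x v % (nbrsIn G R v).card)

theorem Solvable.starMap [NeZero n] {l : ℕ} (hn : n ≤ 2 ^ l) (R : Finset (Fin n))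
    (x : Fin n → ℕ) :
    Solvable (n * (3 + l * 3)) fun G (r : Fin n → Fin n) => IsStarMap G R x r := by
  have h : ∀ v : Fin n, Solvable (3 + l * 3) fun G (w : Fin n) =>
      (v ∈ R → w = v) ∧ (v ∉ R → (nbrsIn G R v).Nonempty → w ∈ nbrsIn G R v ∧
        (below (nbrsIn G R v) w).card = x v % (nbrsIn G R v).card) := by
    intro v
    by_cases hv : v ∈ R
    · exact Solvable.ret _ v fun G => ⟨fun _ => rfl, fun h => absurd hv h⟩
    have hd : Disjoint R {v} := Finset.disjoint_singleton_right.mpr hv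
    refine (Solvable.edgesBetween hd).bind fun m _ => ?_
    -- With a constant threshold, the search ends at the neighbour of `v` that has exactly `x v % m`
    -- neighbours before it.
    refine (Solvable.findVertex hn hd (monotone_const (c := x v % m))).mono le_rfl
      fun G w hw hm => ⟨fun h => absurd h hv, fun _ hne => ?_⟩
    rw [edgesBetween_eq_card_nbrsIn] at hm
    rw [edgesBetween_eq_card_nbrsIn, edgesBetween_eq_card_nbrsIn, nbrsIn_below,
      edgesBetween_singleton, hm] at hw
    obtain ⟨h₁, h₂, h₃⟩ := hw (Nat.mod_lt _ hne.card_pos)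
    split_ifs at h₃ with hadj
    · exact ⟨mem_nbrsIn.mpr ⟨h₁, hadj.symm⟩, by omega⟩
    · omega
  have := Solvable.pi h
  rwa [Fintype.card_fin] at this

/-- The random choices `R` and `x` lead to few stars, none of which meets both sides of `T`. -/
def GoodStars (G : SimpleGraph (Fin n)) (T : Finset (Fin n)) (d b : ℕ) (R : Finset (Fin n))
    (x : Fin n → ℕ) : Prop :=
  R.card * d ≤ b ∧ ∀ v ∉ R, (nbrsIn G R v).Nonempty ∧ ∀ w ∈ nbrsIn G R v,
    (below (nbrsIn G R v) w).card = x v % (nbrsIn G R v).card → (w ∈ T ↔ v ∈ T)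

/-- Every vertex is sent to a centre on its own side of `T`. So no fibre meets both sides, and there
are at most as many fibres as centres. -/
theorem GoodStars.saturated {G : SimpleGraph (Fin n)} {T : Finset (Fin n)} {d b : ℕ}
    {R : Finset (Fin n)} {x : Fin n → ℕ} (h : GoodStars G T d b R x) {r : Fin n → Fin n}
    (hr : IsStarMap G R x r) :
    Saturated r T ∧ (Finset.univ.image r).card * d ≤ b := by
  have key : ∀ v, r v ∈ R ∧ (r v ∈ T ↔ v ∈ T) := by
    intro v
    by_cases hv : v ∈ R
    · rw [(hr v).1 hv]
      exact ⟨hv, Iff.rfl⟩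
    · obtain ⟨hne, hside⟩ := h.2 v hv
      obtain ⟨h₁, h₂⟩ := (hr v).2 hv hne
      exact ⟨(mem_nbrsIn.mp h₁).1, hside _ h₁ h₂⟩
  refine ⟨fun u v huv => by rw [← (key u).2, ← (key v).2, huv], ?_⟩
  refine (Nat.mul_le_mul_right d (Finset.card_le_card ?_)).trans h.1
  intro w hw
  obtain ⟨v, -, rfl⟩ := Finset.mem_image.mp hw
  exact (key v).1

theorem Solvable.contractedCut [NeZero n] {l : ℕ} (hn : n ≤ 2 ^ l) (d b : ℕ)
    (R : Finset (Fin n)) (x : Fin n → ℕ) :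
    Solvable (n * (3 + l * 3) + 2 * (b + n) * (1 + 6 * l)) fun G S =>
      ∀ T : Finset (Fin n), T ≠ ∅ → T ≠ Finset.univ → cutValue G T < d →
        GoodStars G T d b R x → S ≠ ∅ ∧ S ≠ Finset.univ ∧ cutValue G S ≤ cutValue G T := by
  refine (Solvable.starMap hn R x).bind fun r _ => ?_
  -- Giving up when there are too many fibres keeps the query bound valid for all draws.
  by_cases hb : (Finset.univ.image r).card * d ≤ b
  · refine (Solvable.beatsSaturated hn r d).mono ?_ fun G S hS hr T hT₁ hT₂ hT hgood =>
      hS T (hgood.saturated hr).1 hT₁ hT₂ hT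
    have h : (Finset.univ.image r).card ≤ n := by
      simpa using Finset.card_image_le (s := Finset.univ) (f := r)
    gcongr ?_ * _
    rw [mul_assoc]
    gcongr
    rw [add_mul, one_mul, mul_comm d]
    exact add_le_add hb h
  · exact Solvable.ret _ ∅ fun G hr T _ _ _ hgood => absurd (hgood.saturated hr).2 hb

/-- The smallest degree, as the least value of a cut around a single vertex. -/
noncomputable def leastDegree {V : Type} [Fintype V] (G : SimpleGraph V) : ℕ :=
  ⨅ v, cutValue G {v}

theorem leastDegree_le {V : Type} [Fintype V] (G : SimpleGraph V) (v : V) :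
    leastDegree G ≤ cutValue G {v} := ciInf_le (OrderBot.bddBelow _) v

theorem Solvable.leastDegree {V : Type} [Fintype V] :
    Solvable (Fintype.card V) fun (G : SimpleGraph V) d => d = leastDegree G := by
  have h := Solvable.pi (α := ℕ) fun v : V => Solvable.query {v}
  rw [mul_one] at h
  refine h.map (fun f => ⨅ v, f v) fun G f hf => ?_
  rw [funext hf]
  rfl

/-- The algorithm for fixed outcomes of the random draws. -/
theorem Solvable.globalMinCut [NeZero n] (h2 : 2 ≤ n) {l : ℕ} (hn : n ≤ 2 ^ l) (b : ℕ)
    {ι : Type} [Fintype ι] (R : ℕ → ι → Finset (Fin n)) (x : ι → Fin n → ℕ) :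
    Solvable (n + (Fintype.card ι * (n * (3 + l * 3) + 2 * (b + n) * (1 + 6 * l)) +
        (n + Fintype.card ι))) fun G S =>
      ∀ T, IsGlobalMinCut G T → (cutValue G T < CutQuery.leastDegree G →
        ∃ i, GoodStars G T (CutQuery.leastDegree G) b (R (CutQuery.leastDegree G) i) (x i)) →
          IsGlobalMinCut G S := by
  classical
  have hdeg := Solvable.leastDegree (V := Fin n)
  rw [Fintype.card_fin] at hdeg
  refine hdeg.bind fun d _ => ?_
  refine (Solvable.pi fun i => Solvable.contractedCut hn d b (R d i) (x i)).bind fun cand _ => ?_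
  -- The singletons cover the case in which no cut is below the least degree. Improper outputs of
  -- failed trials are discarded.
  let C : Finset (Finset (Fin n)) := Finset.univ.image (fun v : Fin n => {v}) ∪
    (Finset.univ.image cand).filter fun S => S ≠ ∅ ∧ S ≠ Finset.univ
  have hsingle : ∀ v, {v} ∈ C := fun v =>
    Finset.mem_union_left _ (Finset.mem_image_of_mem _ (Finset.mem_univ v))
  have hC : ∀ S ∈ C, S ≠ ∅ ∧ S ≠ Finset.univ := by
    intro S hS
    rcases Finset.mem_union.mp hS with hS | hS
    · obtain ⟨v, -, rfl⟩ := Finset.mem_image.mp hS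
      refine ⟨Finset.singleton_ne_empty v, fun h => ?_⟩
      have := congrArg Finset.card h
      simp only [Finset.card_singleton, Finset.card_univ, Fintype.card_fin] at this
      omega
    · exact (Finset.mem_filter.mp hS).2
  have hcard : C.card ≤ n + Fintype.card ι := by
    refine (Finset.card_union_le _ _).trans (add_le_add ?_ ?_)
    · exact Finset.card_image_le.trans (by simp)
    · exact (Finset.card_filter_le _ _).trans (Finset.card_image_le.trans (by simp))
  refine (Solvable.best C ⟨_, hsingle 0⟩).mono hcard ?_
  rintro G S ⟨hS, hmin⟩ hcand rfl T hT hgood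
  refine ⟨hC S hS, fun U hU₁ hU₂ => le_trans ?_ (hT.2 U hU₁ hU₂)⟩
  by_cases hlt : cutValue G T < CutQuery.leastDegree G
  · obtain ⟨i, hi⟩ := hgood hlt
    obtain ⟨h₁, h₂, h₃⟩ := hcand i T hT.1.1 hT.1.2 hlt hi
    exact (hmin _ (Finset.mem_union_right _ (Finset.mem_filter.mpr
      ⟨Finset.mem_image_of_mem _ (Finset.mem_univ i), h₁, h₂⟩))).trans h₃
  · obtain ⟨v, hv⟩ := ciInf_mem fun v => cutValue G {v}
    have := hmin _ (hsingle v)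
    exact (this.trans hv.le).trans (not_lt.mp hlt)

end Stars

/-! ### Random centres: expectations and tail bounds as counting statements. -/

section Counting

/-- Since `m` divides `N`, every residue is attained equally often: a uniform draw stays uniform
modulo `m`. -/
theorem card_filter_mod_mem {N m : ℕ} (hm : 0 < m) (hmN : m ∣ N) {I : Finset ℕ}
    (hI : I ⊆ Finset.range m) :
    ((Finset.univ.filter fun a : Fin N => (a : ℕ) % m ∈ I).card : ℝ) = N * (I.card / m) := by
  obtain ⟨k, rfl⟩ := hmN
  have key : ∀ i ∈ I,
      ((Finset.univ.filter fun a : Fin (m * k) => (a : ℕ) % m ∈ I).filter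
        fun a : Fin (m * k) => (a : ℕ) % m = i).card = k := by
    intro i hi
    have him := Finset.mem_range.mp (hI hi)
    have hb : ∀ j : Fin k, i + m * (j : ℕ) < m * k := fun j =>
      calc i + m * j < m + m * j := by omega
        _ = m * (j + 1) := by ring
        _ ≤ m * k := Nat.mul_le_mul_left m j.2
    refine (Finset.card_bij (s := (Finset.univ : Finset (Fin k))) (fun j _ => ⟨_, hb j⟩)
      ?_ ?_ ?_).symm.trans (by simp)
    · intro j _
      simp [Nat.add_mul_mod_self_left, Nat.mod_eq_of_lt him, hi]
    · intro j _ j' _ h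
      have h' : i + m * (j : ℕ) = i + m * j' := congrArg Fin.val h
      exact Fin.ext (Nat.eq_of_mul_eq_mul_left hm (by omega))
    · intro a ha
      have ha' := (Finset.mem_filter.mp ha).2
      refine ⟨⟨a / m, Nat.div_lt_of_lt_mul a.2⟩, Finset.mem_univ _, Fin.ext ?_⟩
      simp only
      rw [← ha', Nat.mod_add_div]
  have h := Finset.card_eq_sum_card_fiberwise (t := I) (f := fun a : Fin (m * k) => (a : ℕ) % m)
    (s := Finset.univ.filter fun a : Fin (m * k) => (a : ℕ) % m ∈ I)
    fun a ha => (Finset.mem_filter.mp ha).2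
  rw [Finset.sum_congr rfl key, Finset.sum_const, smul_eq_mul] at h
  rw [h]
  have : (m : ℝ) ≠ 0 := by positivity
  push_cast
  field_simp

theorem card_filter_dvd {N q : ℕ} (hq : 0 < q) (hqN : q ∣ N) :
    ((Finset.univ.filter fun a : Fin N => q ∣ (a : ℕ)).card : ℝ) = N / q := by
  have h := card_filter_mod_mem hq hqN (I := {0}) (by simpa using hq)
  simp only [Finset.mem_singleton, ← Nat.dvd_iff_mod_eq_zero, Finset.card_singleton,
    Nat.cast_one, mul_one_div] at h
  exact h

/-- Markov's inequality in counting form. -/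
theorem card_filter_mul_le_sum {α : Type*} [Fintype α] (X : α → ℝ) (hX : ∀ a, 0 ≤ X a) (c : ℝ)
    (p : α → Prop) [DecidablePred p] (hp : ∀ a, p a → c ≤ X a) :
    ((Finset.univ.filter p).card : ℝ) * c ≤ ∑ a, X a := by
  rw [← nsmul_eq_mul]
  refine (Finset.card_nsmul_le_sum _ _ _ fun a ha => hp a (Finset.mem_filter.mp ha).2).trans ?_
  exact Finset.sum_le_sum_of_subset_of_nonneg (Finset.filter_subset _ _) fun a _ _ => hX a

variable {V : Type} [Fintype V] {N : ℕ}

/-- The random set of centres that is determined by the draws `χ`. -/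
def centers (q : ℕ) (χ : V → Fin N) : Finset V := Finset.univ.filter fun v => q ∣ (χ v : ℕ)

theorem mem_centers {q : ℕ} {χ : V → Fin N} {v : V} : v ∈ centers q χ ↔ q ∣ (χ v : ℕ) := by
  simp [centers]

variable [DecidableEq V]

/-- Independence of the draws: the sum of a product is the product of the sums. -/
theorem sum_prod_apply (w : V → Fin N → ℝ) :
    ∑ χ : V → Fin N, ∏ v, w v (χ v) = ∏ v, ∑ a, w v a := by
  rw [Finset.prod_univ_sum, Fintype.piFinset_univ]

theorem card_filter_mem_centers {q : ℕ} (hq : 0 < q) (hqN : q ∣ N) (v : V) :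
    ((Finset.univ.filter fun χ : V → Fin N => v ∈ centers q χ).card : ℝ) =
      N ^ Fintype.card V / q := by
  have h := sum_prod_apply (N := N) fun u a => if u = v then (if q ∣ (a : ℕ) then 1 else 0) else 1
  simp only [Finset.prod_ite_eq', Finset.mem_univ, if_true] at h
  have h' : ∀ u, (∑ a : Fin N, if u = v then (if q ∣ (a : ℕ) then (1 : ℝ) else 0) else 1) =
      N * if u = v then (1 / q : ℝ) else 1 := by
    intro u
    split_ifs
    · rw [Finset.sum_boole, card_filter_dvd hq hqN]
      ring
    · simp
  rw [Finset.sum_boole, Finset.prod_congr rfl fun u _ => h' u, Finset.prod_mul_distrib,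
    Finset.prod_const, Finset.prod_ite_eq', if_pos (Finset.mem_univ v), Finset.card_univ] at h
  simp only [mem_centers]
  rw [h]
  ring

theorem sum_sum_centers {q : ℕ} (hq : 0 < q) (hqN : q ∣ N) (a : V → ℝ) :
    ∑ χ : V → Fin N, ∑ v ∈ centers q χ, a v = N ^ Fintype.card V / q * ∑ v, a v := by
  simp only [centers, Finset.sum_filter]
  rw [Finset.sum_comm, Finset.mul_sum]
  refine Finset.sum_congr rfl fun v _ => ?_
  rw [← Finset.sum_filter, Finset.sum_const, nsmul_eq_mul, ← card_filter_mem_centers hq hqN v]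
  simp only [mem_centers]

open Classical in
theorem card_filter_sum_centers_ge {q : ℕ} (hq : 0 < q) (hqN : q ∣ N) {a : V → ℝ}
    (ha : ∀ v, 0 ≤ a v) {M : ℝ} (hM : 0 < M) (haM : ∑ v, a v ≤ M) :
    ((Finset.univ.filter fun χ : V → Fin N => 4 * M / q ≤ ∑ v ∈ centers q χ, a v).card : ℝ) ≤
      N ^ Fintype.card V / 4 := by
  have h := card_filter_mul_le_sum (fun χ : V → Fin N => ∑ v ∈ centers q χ, a v)
    (fun χ => Finset.sum_nonneg fun v _ => ha v) (4 * M / q)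
    (fun χ => 4 * M / q ≤ ∑ v ∈ centers q χ, a v) fun χ h => h
  rw [sum_sum_centers hq hqN] at h
  have hq' : (0 : ℝ) < q := by exact_mod_cast hq
  have h' := h.trans (mul_le_mul_of_nonneg_left haM (by positivity))
  have e₁ : ∀ y : ℝ, y * (4 * M / q) = y * 4 * (M / q) := fun y => by ring
  have e₂ : (N : ℝ) ^ Fintype.card V / q * M = N ^ Fintype.card V * (M / q) := by ring
  rw [e₁, e₂] at h'
  have := le_of_mul_le_mul_right h' (by positivity)
  linarith

/-- By independence each vertex of `B` contributes the factor `1 - (1 - 1/e) / q ≤ 1 - 1 / (2q) ≤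
exp (-1 / (2q))`. -/
theorem sum_exp_neg_card_le {q : ℕ} (hq : 0 < q) (hqN : q ∣ N) (B : Finset V) :
    ∑ χ : V → Fin N, Real.exp (-((B ∩ centers q χ).card : ℝ)) ≤
      N ^ Fintype.card V * Real.exp (-(B.card / (2 * q))) := by
  have hq' : (0 : ℝ) < q := by exact_mod_cast hq
  have h₁ : ∀ χ : V → Fin N, Real.exp (-((B ∩ centers q χ).card : ℝ)) =
      ∏ v, if v ∈ B then (if q ∣ (χ v : ℕ) then Real.exp (-1) else 1) else 1 := by
    intro χ
    rw [Finset.prod_ite_mem, Finset.univ_inter, ← Finset.prod_filter, Finset.prod_const,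
      ← Real.exp_nat_mul]
    congr 1
    have : B ∩ centers q χ = B.filter fun v => q ∣ (χ v : ℕ) := by
      ext v
      simp [mem_centers]
    rw [this]
    ring
  have h₂ : ∀ v, (∑ a : Fin N, if v ∈ B then (if q ∣ (a : ℕ) then Real.exp (-1) else 1) else 1) ≤
      N * if v ∈ B then Real.exp (-(1 / (2 * q))) else 1 := by
    intro v
    split_ifs
    · have e : ∀ a : Fin N, (if q ∣ (a : ℕ) then Real.exp (-1) else 1) =
          1 - (1 - Real.exp (-1)) * if q ∣ (a : ℕ) then 1 else 0 := by
        intro a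
        split_ifs <;> ring
      rw [Finset.sum_congr rfl fun a _ => e a, Finset.sum_sub_distrib, ← Finset.mul_sum,
        Finset.sum_boole, card_filter_dvd hq hqN]
      simp only [Finset.sum_const, Finset.card_univ, Fintype.card_fin, nsmul_eq_mul, mul_one]
      have he : Real.exp (-1) ≤ 1 / 2 := by
        rw [Real.exp_neg, ← one_div]
        exact one_div_le_one_div_of_le two_pos (by have := Real.add_one_le_exp 1; linarith)
      have := Real.add_one_le_exp (-(1 / (2 * (q : ℝ))))
      have hN : (0 : ℝ) ≤ N := Nat.cast_nonneg N
      calc (N : ℝ) - (1 - Real.exp (-1)) * (N / q) ≤ N - 1 / 2 * (N / q) := by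
            gcongr
            linarith
        _ = N * (-(1 / (2 * q)) + 1) := by
            field_simp
            ring
        _ ≤ _ := by gcongr
    · simp
  simp only [h₁]
  rw [sum_prod_apply fun v (a : Fin N) =>
    if v ∈ B then (if q ∣ (a : ℕ) then Real.exp (-1) else 1) else 1]
  refine (Finset.prod_le_prod (fun v _ => Finset.sum_nonneg fun a _ => ?_)
    fun v _ => h₂ v).trans_eq ?_
  · split_ifs <;> positivity
  · rw [Finset.prod_mul_distrib, Finset.prod_const, Finset.prod_ite_mem, Finset.univ_inter,
      Finset.prod_const, ← Real.exp_nat_mul, Finset.card_univ]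
    congr 2
    ring

/-- A lower tail bound for the number of centres in a given set. -/
theorem card_filter_card_inter_centers_le {q : ℕ} (hq : 0 < q) (hqN : q ∣ N) (B : Finset V)
    {s : ℝ} (hs : 4 * q * s ≤ B.card) :
    ((Finset.univ.filter fun χ : V → Fin N => ((B ∩ centers q χ).card : ℝ) ≤ s).card : ℝ) ≤
      N ^ Fintype.card V * Real.exp (-s) := by
  have hq' : (0 : ℝ) < q := by exact_mod_cast hq
  have h := card_filter_mul_le_sum (fun χ : V → Fin N => Real.exp (-((B ∩ centers q χ).card : ℝ)))
    (fun χ => (Real.exp_pos _).le) (Real.exp (-s))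
    (fun χ => ((B ∩ centers q χ).card : ℝ) ≤ s) fun χ h => by gcongr
  have h' := h.trans (sum_exp_neg_card_le hq hqN B)
  -- The hypothesis on `B` gives `exp (-2s)`; Markov's inequality uses up one of the two factors
  -- `exp (-s)`.
  have h'' : Real.exp (-(B.card / (2 * q))) ≤ Real.exp (-s) * Real.exp (-s) := by
    rw [← Real.exp_add]
    gcongr
    have : 2 * s ≤ B.card / (2 * q) := by
      rw [le_div_iff₀ (by positivity)]
      linarith
    linarith
  have h₃ := h'.trans (mul_le_mul_of_nonneg_left h'' (by positivity))
  rw [← mul_assoc] at h₃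
  exact le_of_mul_le_mul_right h₃ (Real.exp_pos _)

end Counting

/-! ### Random picks among the adjacent centres. -/

section Picks

/-- `(s + c) / s = 1 + c / s ≤ 1 + c / β ≤ exp (c / β)`. The exponential form makes the bounds for
different vertices multiply to one that depends only on the total of the `c`. -/
theorem exp_neg_div_mul_add_le {β s c : ℝ} (hβ : 0 < β) (hs : β ≤ s) (hc : 0 ≤ c) :
    Real.exp (-(c / β)) * (s + c) ≤ s := by
  have hs0 : 0 < s := hβ.trans_le hs
  have h : s + c ≤ s * Real.exp (c / β) := by
    calc s + c = s * (c / s + 1) := by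
          field_simp
          ring
      _ ≤ s * (c / β + 1) := by gcongr
      _ ≤ s * Real.exp (c / β) := by
        gcongr
        exact Real.add_one_le_exp _
  calc Real.exp (-(c / β)) * (s + c) ≤ Real.exp (-(c / β)) * (s * Real.exp (c / β)) := by gcongr
    _ = s * (Real.exp (-(c / β)) * Real.exp (c / β)) := by ring
    _ = s := by rw [← Real.exp_add, neg_add_cancel, Real.exp_zero, mul_one]

variable {n N : ℕ}

theorem card_below_lt {A : Finset (Fin n)} {w : Fin n} (hw : w ∈ A) :
    (below A w).card < A.card :=
  Finset.card_lt_card ((Finset.ssubset_iff_of_subset (below_subset A w)).mpr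
    ⟨w, hw, by simp [below]⟩)

theorem card_below_injOn (A : Finset (Fin n)) :
    Set.InjOn (fun w : Fin n => (below A w).card) A := by
  have key : ∀ u ∈ A, ∀ w : Fin n, u < w → (below A u).card < (below A w).card := by
    intro u hu w huw
    refine Finset.card_lt_card ((Finset.ssubset_iff_of_subset fun x hx => ?_).mpr
      ⟨u, by simp [below, hu, huw], by simp [below]⟩)
    simp only [below, Finset.mem_filter] at hx ⊢
    exact ⟨hx.1, hx.2.trans huw⟩
  intro u hu w hw h
  rcases lt_trichotomy u w with huw | huw | huw
  · exact absurd h (key u hu w huw).ne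
  · exact huw
  · exact absurd h (key w hw u huw).ne'

-- Ranks in `A` are distinct and run through the residues modulo `A.card`, so the element selected
-- by a uniform draw is uniform in `A`.
open Classical in
theorem le_card_filter_pick (A : Finset (Fin n)) (hA : A.Nonempty) (hN : A.card ∣ N)
    (p : Fin n → Prop) :
    (N : ℝ) * ((A.filter p).card / A.card) ≤ (Finset.univ.filter fun a : Fin N =>
      ∀ w ∈ A, (below A w).card = (a : ℕ) % A.card → p w).card := by
  have hinj := (card_below_injOn A).mono (Finset.coe_subset.mpr (Finset.filter_subset p A))
  rw [← Finset.card_image_of_injOn hinj, ← card_filter_mod_mem hA.card_pos hN]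
  · refine Nat.cast_le.mpr (Finset.card_le_card fun a ha => ?_)
    obtain ⟨u, hu, hua⟩ := Finset.mem_image.mp (Finset.mem_filter.mp ha).2
    rw [Finset.mem_filter] at hu
    refine Finset.mem_filter.mpr ⟨Finset.mem_univ _, fun w hw hwa => ?_⟩
    rw [card_below_injOn A hw hu.1 (hwa.trans hua.symm)]
    exact hu.2
  · intro i hi
    obtain ⟨u, hu, rfl⟩ := Finset.mem_image.mp hi
    exact Finset.mem_range.mpr (card_below_lt (Finset.mem_filter.mp hu).1)

open Classical in
theorem exp_le_card_filter_pick {β : ℝ} (hβ : 0 < β) (hN : ∀ m, 0 < m → m ≤ n → m ∣ N)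
    (A : Finset (Fin n)) (p : Fin n → Prop) (hp : β ≤ (A.filter p).card) :
    (N : ℝ) * Real.exp (-((A.filter fun w => ¬ p w).card / β)) ≤
      (Finset.univ.filter fun a : Fin N =>
        ∀ w ∈ A, (below A w).card = (a : ℕ) % A.card → p w).card := by
  have hsum := Finset.card_filter_add_card_filter_not (s := A) p
  have hs0 : (0 : ℝ) < (A.filter p).card := hβ.trans_le hp
  have hs1 : 0 < (A.filter p).card := by exact_mod_cast hs0
  have hA : A.Nonempty := Finset.card_pos.mp (by omega)
  have hAn : A.card ≤ n := by simpa using Finset.card_le_univ A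
  refine le_trans ?_ (le_card_filter_pick A hA (hN _ hA.card_pos hAn) p)
  refine mul_le_mul_of_nonneg_left ?_ (Nat.cast_nonneg N)
  rw [← hsum, Nat.cast_add, le_div_iff₀ (by positivity)]
  exact exp_neg_div_mul_add_le hβ hp (Nat.cast_nonneg _)

open Classical in
/-- If every set `A v` contains many elements with property `p v`, and there are few elements
without it in total, then all random picks have the property with constant probability. -/
theorem exp_le_card_filter_picks {β K : ℝ} (hβ : 0 < β) (hN : ∀ m, 0 < m → m ≤ n → m ∣ N)
    (A : Fin n → Finset (Fin n)) (p : Fin n → Fin n → Prop)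
    (hp : ∀ v, β ≤ ((A v).filter (p v)).card)
    (hnp : ∑ v, (((A v).filter fun w => ¬ p v w).card : ℝ) ≤ K * β) :
    (N : ℝ) ^ n * Real.exp (-K) ≤ (Finset.univ.filter fun x : Fin n → Fin N =>
      ∀ v, ∀ w ∈ A v, (below (A v) w).card = (x v : ℕ) % (A v).card → p v w).card := by
  have hpi : (Finset.univ.filter fun x : Fin n → Fin N =>
      ∀ v, ∀ w ∈ A v, (below (A v) w).card = (x v : ℕ) % (A v).card → p v w) =
      Fintype.piFinset fun v => Finset.univ.filter fun a : Fin N =>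
        ∀ w ∈ A v, (below (A v) w).card = (a : ℕ) % (A v).card → p v w := by
    ext x
    simp [Fintype.mem_piFinset]
  rw [hpi, Fintype.card_piFinset, Nat.cast_prod]
  refine le_trans ?_ (Finset.prod_le_prod (fun v _ => by positivity) fun v _ =>
    exp_le_card_filter_pick hβ hN (A v) (p v) (hp v))
  rw [Finset.prod_mul_distrib, Finset.prod_const, Finset.card_univ, Fintype.card_fin,
    ← Real.exp_sum]
  gcongr
  rw [Finset.sum_neg_distrib, ← Finset.sum_div, neg_le_neg_iff, div_le_iff₀ hβ]
  exact hnp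

end Picks

/-! ### Neighbourhoods in a minimum cut. -/

section MinCuts

variable {V : Type}

/-- `v` and `w` are on the same side of the cut around `T`. -/
def SameSide (T : Finset V) (v w : V) : Prop := w ∈ T ↔ v ∈ T

theorem sum_card_nbrsIn (G : SimpleGraph V) (A B : Finset V) :
    ∑ v ∈ B, (nbrsIn G A v).card = edgesBetween G A B := by
  classical
  rw [edgesBetween_comm, edgesBetween]
  exact Finset.sum_congr rfl fun v _ => by rw [nbrsIn, Finset.card_filter]

variable [Fintype V]

open Classical in
/-- The neighbours of `v` that are on its own side. -/
noncomputable def ownNbrs (G : SimpleGraph V) (T : Finset V) (v : V) : Finset V :=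
  (nbrsIn G Finset.univ v).filter (SameSide T v)

open Classical in
/-- The neighbours of `v` that are on the other side. -/
noncomputable def crossNbrs (G : SimpleGraph V) (T : Finset V) (v : V) : Finset V :=
  (nbrsIn G Finset.univ v).filter fun w => ¬ SameSide T v w

variable [DecidableEq V]

open Classical in
theorem ownNbrs_inter (G : SimpleGraph V) (T R : Finset V) (v : V) :
    ownNbrs G T v ∩ R = (nbrsIn G R v).filter (SameSide T v) := by
  ext w
  simp only [ownNbrs, Finset.mem_inter, Finset.mem_filter, mem_nbrsIn, Finset.mem_univ, true_and]
  tauto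

-- Double counting of the pairs (vertex, adjacent centre on the other side).
open Classical in
theorem sum_card_cross_centers (G : SimpleGraph V) (T R : Finset V) :
    ∑ v, ((nbrsIn G R v).filter fun w => ¬ SameSide T v w).card =
      ∑ w ∈ R, (crossNbrs G T w).card := by
  have h : ∀ v, ((nbrsIn G R v).filter fun w => ¬ SameSide T v w).card =
      ∑ w ∈ R, if G.Adj v w ∧ ¬ SameSide T v w then 1 else 0 := by
    intro v
    rw [nbrsIn, Finset.filter_filter, Finset.card_filter]
  rw [Finset.sum_congr rfl fun v _ => h v, Finset.sum_comm]
  refine Finset.sum_congr rfl fun w _ => ?_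
  rw [crossNbrs, nbrsIn, Finset.filter_filter, Finset.card_filter]
  refine Finset.sum_congr rfl fun v _ => if_congr ?_ rfl rfl
  rw [G.adj_comm, SameSide, SameSide]
  tauto

theorem sum_card_crossNbrs (G : SimpleGraph V) (T : Finset V) :
    ∑ v, (crossNbrs G T v).card = 2 * cutValue G T := by
  have h₁ : ∀ v ∈ T, (crossNbrs G T v).card = (nbrsIn G Tᶜ v).card := by
    intro v hv
    congr 1
    ext w
    simp [crossNbrs, mem_nbrsIn, SameSide, hv, and_comm]
  have h₂ : ∀ v ∈ Tᶜ, (crossNbrs G T v).card = (nbrsIn G T v).card := by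
    intro v hv
    rw [Finset.mem_compl] at hv
    congr 1
    ext w
    simp [crossNbrs, mem_nbrsIn, SameSide, hv, and_comm]
  rw [← Finset.sum_add_sum_compl T, Finset.sum_congr rfl h₁, Finset.sum_congr rfl h₂,
    sum_card_nbrsIn, sum_card_nbrsIn, cutValue_eq, edgesBetween_comm G Tᶜ T]
  omega

theorem IsGlobalMinCut.compl {G : SimpleGraph V} {T : Finset V} (h : IsGlobalMinCut G T) :
    IsGlobalMinCut G Tᶜ := by
  refine ⟨⟨fun h' => h.1.2 (Finset.compl_eq_empty_iff T |>.mp h'),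
    fun h' => h.1.1 (Finset.compl_eq_univ_iff T |>.mp h')⟩, fun U h₁ h₂ => ?_⟩
  rw [cutValue_compl]
  exact h.2 U h₁ h₂

/-- Compare `T` with `T.erase v`, which cannot be a smaller cut. The strict inequality excludes `T =
{v}`, for which the comparison would not be allowed. -/
theorem IsGlobalMinCut.le_two_mul {G : SimpleGraph V} {T : Finset V} (h : IsGlobalMinCut G T)
    {v : V} (hv : v ∈ T) (hlt : cutValue G T < cutValue G {v}) :
    cutValue G {v} ≤ 2 * (nbrsIn G (T.erase v) v).card := by
  have hd : Disjoint (T.erase v) {v} := by simp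
  have hu : T.erase v ∪ {v} = T := by
    rw [Finset.union_comm, ← Finset.insert_eq, Finset.insert_erase hv]
  have hadd := cutValue_add_cutValue G hd
  rw [hu, edgesBetween_eq_card_nbrsIn] at hadd
  have hmin : cutValue G T ≤ cutValue G (T.erase v) := by
    refine h.2 _ (fun he => ?_) fun he => ?_
    · rw [he, Finset.empty_union] at hu
      rw [hu] at hlt
      exact hlt.false
    · have := Finset.mem_univ v
      rw [← he] at this
      exact Finset.notMem_erase v T this
  omega

/-- In a minimum cut that is smaller than all degrees, every vertex has at least half of its
neighbours on its own side. -/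
theorem IsGlobalMinCut.leastDegree_le {G : SimpleGraph V} {T : Finset V}
    (h : IsGlobalMinCut G T) (hlt : cutValue G T < leastDegree G) (v : V) :
    leastDegree G ≤ 2 * (ownNbrs G T v).card := by
  have hdeg := CutQuery.leastDegree_le G v
  refine hdeg.trans ?_
  by_cases hv : v ∈ T
  · refine (h.le_two_mul hv (hlt.trans_le hdeg)).trans
      (Nat.mul_le_mul_left 2 (Finset.card_le_card fun w hw => ?_))
    simp only [mem_nbrsIn, Finset.mem_erase] at hw
    simp [ownNbrs, mem_nbrsIn, SameSide, hv, hw]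
  · refine (h.compl.le_two_mul (Finset.mem_compl.mpr hv) ?_).trans
      (Nat.mul_le_mul_left 2 (Finset.card_le_card fun w hw => ?_))
    · rw [cutValue_compl]
      exact hlt.trans_le hdeg
    · simp only [mem_nbrsIn, Finset.mem_erase, Finset.mem_compl] at hw
      simp [ownNbrs, mem_nbrsIn, SameSide, hv, hw]

theorem leastDegree_le_card [Nonempty V] (G : SimpleGraph V) :
    leastDegree G ≤ Fintype.card V := by
  obtain ⟨v⟩ := ‹Nonempty V›
  refine (leastDegree_le G v).trans ?_
  rw [cutValue_eq, edgesBetween_comm, edgesBetween_eq_card_nbrsIn]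
  exact Finset.card_le_univ _

theorem exists_isGlobalMinCut [Nontrivial V] (G : SimpleGraph V) :
    ∃ T, IsGlobalMinCut G T := by
  classical
  obtain ⟨u, v, huv⟩ := exists_pair_ne V
  obtain ⟨T, hT, hmin⟩ := Finset.exists_min_image
    (Finset.univ.filter fun S : Finset V => S ≠ ∅ ∧ S ≠ Finset.univ) (cutValue G)
    ⟨{u}, Finset.mem_filter.mpr ⟨Finset.mem_univ _, Finset.singleton_ne_empty u, fun h => by
      have := Finset.mem_univ v
      rw [← h, Finset.mem_singleton] at this
      exact huv this.symm⟩⟩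
  exact ⟨T, (Finset.mem_filter.mp hT).2, fun U h₁ h₂ =>
    hmin U (Finset.mem_filter.mpr ⟨Finset.mem_univ _, h₁, h₂⟩)⟩

end MinCuts

/-! ### Success probability of one contraction. -/

section Probability

variable {n N l : ℕ}

/-- The inverse of the probability with which a vertex becomes a centre. -/
def sparsity (l d : ℕ) : ℕ := max 1 (d / (24 * l))

theorem sparsity_pos (l d : ℕ) : 0 < sparsity l d := lt_max_of_lt_left one_pos

theorem le_mul_sparsity (hl : 0 < l) (d : ℕ) : d ≤ 48 * l * sparsity l d := by
  have h₁ : d < 24 * l * (d / (24 * l) + 1) := Nat.lt_mul_div_succ d (by omega)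
  have h₂ : d / (24 * l) + 1 ≤ 2 * sparsity l d := by
    have := le_max_left 1 (d / (24 * l))
    have := le_max_right 1 (d / (24 * l))
    unfold sparsity
    omega
  calc d ≤ 24 * l * (d / (24 * l) + 1) := h₁.le
    _ ≤ 24 * l * (2 * sparsity l d) := Nat.mul_le_mul_left _ h₂
    _ = _ := by ring

/-- The constant 24 makes the required number `d / (8q)` of own-side centres at least `3 * l`, which
is what the union bound over all vertices needs. -/
theorem mul_sparsity_le {d : ℕ} (h : sparsity l d ≠ 1) : 24 * l * sparsity l d ≤ d := by
  have : sparsity l d = d / (24 * l) := by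
    unfold sparsity at h ⊢
    omega
  rw [this]
  exact Nat.mul_div_le d _

theorem sparsity_le {d : ℕ} (hd : d ≤ n) (hn : 0 < n) : sparsity l d ≤ n :=
  max_le hn ((Nat.div_le_self _ _).trans hd)

theorem exp_neg_three_mul_le (hl : 0 < l) (hn : n ≤ 2 ^ l) :
    n * Real.exp (-(3 * l)) ≤ 1 / 4 := by
  have h2 : (2 : ℝ) ≤ Real.exp 1 := by
    have := Real.add_one_le_exp 1
    linarith
  have h₁ : ((2 : ℝ) ^ l) ^ 3 ≤ Real.exp (3 * l) := by
    rw [← pow_mul, mul_comm l 3, show (3 * l : ℝ) = ((3 * l : ℕ) : ℝ) * 1 by push_cast; ring,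
      Real.exp_nat_mul]
    gcongr
  have h₂ : (2 : ℝ) ≤ 2 ^ l := by
    calc (2 : ℝ) = 2 ^ 1 := (pow_one 2).symm
      _ ≤ 2 ^ l := pow_le_pow_right₀ (by norm_num) hl
  have h₃ : (n : ℝ) ≤ 2 ^ l := by exact_mod_cast hn
  have h₄ : (4 : ℝ) * n ≤ Real.exp (3 * l) := by
    refine le_trans ?_ h₁
    have : (4 : ℝ) ≤ (2 ^ l) ^ 2 := by nlinarith
    calc (4 : ℝ) * n ≤ (2 ^ l) ^ 2 * 2 ^ l := by gcongr
      _ = _ := by ring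
  rw [Real.exp_neg, ← div_eq_mul_inv, div_le_iff₀ (Real.exp_pos _)]
  linarith

open Classical in
/-- With constant probability, the centres hit all neighbourhoods well. -/
theorem le_card_filter_centers [NeZero n] {G : SimpleGraph (Fin n)} {T : Finset (Fin n)}
    (hT : IsGlobalMinCut G T) (hlt : cutValue G T < leastDegree G) (hl : 0 < l) (hn : n ≤ 2 ^ l)
    {q : ℕ} (hq : 0 < q) (hqN : q ∣ N) (hqd : 24 * l * q ≤ leastDegree G) :
    (N : ℝ) ^ n / 4 ≤ (Finset.univ.filter fun χ : Fin n → Fin N =>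
      ((centers q χ).card : ℝ) ≤ 4 * n / q ∧
      (∑ w ∈ centers q χ, ((crossNbrs G T w).card : ℝ)) ≤ 4 * (2 * leastDegree G) / q ∧
      ∀ v, (leastDegree G / (8 * q) : ℝ) ≤ (ownNbrs G T v ∩ centers q χ).card).card := by
  set d := leastDegree G with hd
  have hq' : (0 : ℝ) < q := by exact_mod_cast hq
  have hd0 : (0 : ℝ) < d := by exact_mod_cast (Nat.zero_le _).trans_lt hlt
  have hn0 : (0 : ℝ) < n := by exact_mod_cast Nat.pos_of_neZero n
  -- The bad events are too many centres, too many crossing pairs and, for each `v`, too few centres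
  -- on its own side. The first, the second and the union of the third kind each have probability at
  -- most 1/4.
  set E₁ := Finset.univ.filter fun χ : Fin n → Fin N => 4 * n / q ≤ ∑ w ∈ centers q χ, (1 : ℝ)
  set E₂ := Finset.univ.filter fun χ : Fin n → Fin N =>
    4 * (2 * d) / q ≤ ∑ w ∈ centers q χ, ((crossNbrs G T w).card : ℝ)
  set E₃ := fun v => Finset.univ.filter fun χ : Fin n → Fin N =>
    ((ownNbrs G T v ∩ centers q χ).card : ℝ) ≤ d / (8 * q)
  set H := Finset.univ.filter fun χ : Fin n → Fin N =>
      ((centers q χ).card : ℝ) ≤ 4 * n / q ∧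
      (∑ w ∈ centers q χ, ((crossNbrs G T w).card : ℝ)) ≤ 4 * (2 * d) / q ∧
      ∀ v, (d / (8 * q) : ℝ) ≤ (ownNbrs G T v ∩ centers q χ).card
  have h₁ : (E₁.card : ℝ) ≤ N ^ n / 4 := by
    have := card_filter_sum_centers_ge (V := Fin n) hq hqN (a := fun _ => 1)
      (fun _ => zero_le_one) hn0 (by simp)
    rwa [Fintype.card_fin] at this
  have h₂ : (E₂.card : ℝ) ≤ N ^ n / 4 := by
    have := card_filter_sum_centers_ge (V := Fin n) hq hqN
      (a := fun w => ((crossNbrs G T w).card : ℝ)) (fun _ => Nat.cast_nonneg _)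
      (M := 2 * d) (by positivity) (by
        rw [← Nat.cast_sum, sum_card_crossNbrs]
        exact_mod_cast Nat.mul_le_mul_left 2 hlt.le)
    rwa [Fintype.card_fin] at this
  have h₃ : ∀ v, ((E₃ v).card : ℝ) ≤ N ^ n * Real.exp (-(3 * l)) := by
    intro v
    have hs : 4 * q * (d / (8 * q) : ℝ) ≤ (ownNbrs G T v).card := by
      have h : (d : ℝ) ≤ 2 * (ownNbrs G T v).card := by
        exact_mod_cast hT.leastDegree_le hlt v
      have e : 4 * q * (d / (8 * q) : ℝ) = d / 2 := by
        field_simp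
        norm_num
      rw [e]
      linarith
    have := card_filter_card_inter_centers_le (N := N) hq hqN (ownNbrs G T v) hs
    rw [Fintype.card_fin] at this
    refine this.trans ?_
    gcongr
    rw [le_div_iff₀ (by positivity)]
    have h : (24 * l * q : ℝ) ≤ d := by exact_mod_cast hqd
    linarith
  have hcover : (Finset.univ : Finset (Fin n → Fin N)) ⊆
      H ∪ (E₁ ∪ (E₂ ∪ Finset.univ.biUnion E₃)) := by
    intro χ _
    simp only [H, E₁, E₂, E₃, Finset.mem_union, Finset.mem_filter, Finset.mem_univ, true_and,
      Finset.mem_biUnion, Finset.sum_const, nsmul_eq_mul, mul_one]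
    by_contra! h
    obtain ⟨h, h₁, h₂, h₃⟩ := h
    obtain ⟨v, hv⟩ := h h₁.le h₂.le
    exact (hv.trans (h₃ v)).false
  have hcard := (Finset.card_le_card hcover).trans ((Finset.card_union_le _ _).trans
    (Nat.add_le_add_left ((Finset.card_union_le _ _).trans (Nat.add_le_add_left
      ((Finset.card_union_le _ _).trans (Nat.add_le_add_left Finset.card_biUnion_le _)) _)) _))
  have hcard' : (N : ℝ) ^ n ≤ H.card + (E₁.card + (E₂.card + ∑ v, ((E₃ v).card : ℝ))) := by
    rw [Finset.card_univ, Fintype.card_pi_const, Fintype.card_fin] at hcard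
    exact_mod_cast hcard
  have hsum : ∑ v, ((E₃ v).card : ℝ) ≤ N ^ n / 4 := by
    calc ∑ v, ((E₃ v).card : ℝ) ≤ ∑ _v : Fin n, N ^ n * Real.exp (-(3 * l)) :=
          Finset.sum_le_sum fun v _ => h₃ v
      _ = N ^ n * (n * Real.exp (-(3 * l))) := by
          rw [Finset.sum_const, Finset.card_univ, Fintype.card_fin, nsmul_eq_mul]
          ring
      _ ≤ N ^ n * (1 / 4) := by
          gcongr
          exact exp_neg_three_mul_le hl hn
      _ = _ := by ring
  linarith

open Classical in
/-- The random star contraction preserves a nontrivial minimum cut with constant probability. -/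
theorem le_card_filter_goodStars [NeZero n] {G : SimpleGraph (Fin n)} {T : Finset (Fin n)}
    (hT : IsGlobalMinCut G T) (hlt : cutValue G T < leastDegree G) (hl : 0 < l) (hn : n ≤ 2 ^ l)
    (hN : ∀ m, 0 < m → m ≤ n → m ∣ N) :
    (N : ℝ) ^ n * N ^ n * (Real.exp (-64) / 4) ≤
      (Finset.univ.filter fun ω : (Fin n → Fin N) × (Fin n → Fin N) =>
        GoodStars G T (leastDegree G) (192 * n * l) (centers (sparsity l (leastDegree G)) ω.1)
          fun v => (ω.2 v : ℕ)).card := by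
  have hdn : leastDegree G ≤ n := by
    have := leastDegree_le_card G
    rwa [Fintype.card_fin] at this
  have hd0 : (0 : ℝ) < leastDegree G := by exact_mod_cast (Nat.zero_le _).trans_lt hlt
  have hup := le_mul_sparsity hl (leastDegree G)
  have hq := sparsity_pos l (leastDegree G)
  have hqn : sparsity l (leastDegree G) ≤ n := sparsity_le hdn (Nat.pos_of_neZero n)
  have hlow := mul_sparsity_le (l := l) (d := leastDegree G)
  generalize sparsity l (leastDegree G) = q at *
  have hq' : (0 : ℝ) < q := by exact_mod_cast hq
  by_cases hq1 : q = 1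
  -- Small degrees: every vertex is a centre, nothing is contracted, and `n * d` is already within
  -- the budget.
  · subst hq1
    have hall : ∀ ω : (Fin n → Fin N) × (Fin n → Fin N),
        GoodStars G T (leastDegree G) (192 * n * l) (centers 1 ω.1) fun v => (ω.2 v : ℕ) := by
      intro ω
      refine ⟨?_, fun v hv => (hv (mem_centers.mpr (one_dvd _))).elim⟩
      have hcard : (centers 1 ω.1).card ≤ n := by
        simpa using Finset.card_le_univ (centers 1 ω.1)
      calc (centers 1 ω.1).card * leastDegree G ≤ n * (48 * l * 1) := Nat.mul_le_mul hcard hup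
        _ ≤ 192 * n * l := by nlinarith
    rw [Finset.filter_true_of_mem fun ω _ => hall ω, Finset.card_univ, Fintype.card_prod,
      Fintype.card_pi_const, Fintype.card_fin]
    push_cast
    have : Real.exp (-64) ≤ 1 := Real.exp_le_one_iff.mpr (by norm_num)
    exact mul_le_of_le_one_right (by positivity) (by linarith)
  · have hlow := hlow hq1
    set H := Finset.univ.filter fun χ : Fin n → Fin N =>
      ((centers q χ).card : ℝ) ≤ 4 * n / q ∧
      (∑ w ∈ centers q χ, ((crossNbrs G T w).card : ℝ)) ≤ 4 * (2 * leastDegree G) / q ∧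
      ∀ v, (leastDegree G / (8 * q) : ℝ) ≤ (ownNbrs G T v ∩ centers q χ).card
    have hH : (N : ℝ) ^ n / 4 ≤ H.card :=
      le_card_filter_centers hT hlt hl hn hq (hN q hq hqn) hlow
    have hfib : ∀ χ ∈ H, (N : ℝ) ^ n * Real.exp (-64) ≤
        (Finset.univ.filter fun x : Fin n → Fin N => GoodStars G T (leastDegree G) (192 * n * l)
          (centers q χ) fun v => (x v : ℕ)).card := by
      intro χ hχ
      obtain ⟨h₁, h₂, h₃⟩ := (Finset.mem_filter.mp hχ).2
      have hβ : (0 : ℝ) < leastDegree G / (8 * q) := by positivity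
      have hsame : ∀ v, (leastDegree G / (8 * q) : ℝ) ≤
          ((nbrsIn G (centers q χ) v).filter (SameSide T v)).card := by
        intro v
        rw [← ownNbrs_inter]
        exact h₃ v
      refine (exp_le_card_filter_picks (N := N) hβ hN (nbrsIn G (centers q χ)) (SameSide T) hsame
        (K := 64) ?_).trans (Nat.cast_le.mpr (Finset.card_le_card fun x hx => ?_))
      -- The constant is `64 = (8 d / q) / (d / (8 q))`.
      · rw [← Nat.cast_sum, sum_card_cross_centers, Nat.cast_sum]
        refine h₂.trans_eq ?_
        field_simp
        norm_num
      · refine Finset.mem_filter.mpr ⟨Finset.mem_univ _, ?_, fun v _ =>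
          ⟨?_, (Finset.mem_filter.mp hx).2 v⟩⟩
        · have hup' : (leastDegree G : ℝ) ≤ 48 * l * q := by exact_mod_cast hup
          have : ((centers q χ).card : ℝ) * leastDegree G ≤ 192 * n * l := by
            calc ((centers q χ).card : ℝ) * leastDegree G ≤ 4 * n / q * (48 * l * q) := by gcongr
              _ = 192 * n * l := by
                field_simp
                ring
          exact_mod_cast this
        · have h : (0 : ℝ) < ((nbrsIn G (centers q χ) v).filter (SameSide T v)).card :=
            hβ.trans_le (hsame v)
          obtain ⟨w, hw⟩ := Finset.card_pos.mp (Nat.cast_pos.mp h)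
          exact ⟨w, (Finset.mem_filter.mp hw).1⟩
    rw [Finset.card_filter, Fintype.sum_prod_type]
    simp only [← Finset.card_filter]
    rw [Nat.cast_sum]
    calc (N : ℝ) ^ n * N ^ n * (Real.exp (-64) / 4) = N ^ n / 4 * (N ^ n * Real.exp (-64)) := by
          ring
      _ ≤ H.card * (N ^ n * Real.exp (-64)) := by gcongr
      _ = ∑ _χ ∈ H, (N : ℝ) ^ n * Real.exp (-64) := by rw [Finset.sum_const, nsmul_eq_mul]
      _ ≤ ∑ χ ∈ H, ((Finset.univ.filter fun x : Fin n → Fin N => GoodStars G T (leastDegree G)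
          (192 * n * l) (centers q χ) fun v => (x v : ℕ)).card : ℝ) := Finset.sum_le_sum hfib
      _ ≤ _ := Finset.sum_le_sum_of_subset_of_nonneg (Finset.subset_univ _)
          fun _ _ _ => Nat.cast_nonneg _

end Probability

/-! ### Repetition, the query bound and the algorithm. -/

section Assembly

/-- A uniformly random choice among finitely many query strategies is an algorithm. -/
theorem exists_algorithm_uniform {V Ω : Type} [Fintype V] [Fintype Ω] [Nonempty Ω]
    (τ : Ω → QueryTree V (Finset V)) :
    ∃ A : Algorithm V, ∀ G : SimpleGraph V,
      A.run G = (PMF.uniformOfFintype Ω).map fun ω => ((τ ω).eval G, (τ ω).cost G) := by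
  have hinj : Function.Injective fun ω => (Fintype.equivFin Ω ω : ℕ) :=
    Fin.val_injective.comp (Fintype.equivFin Ω).injective
  -- The model draws natural numbers, so `Ω` is encoded by an enumeration and decoded before the
  -- strategy is run.
  refine ⟨.sample ((PMF.uniformOfFintype Ω).map fun ω => (Fintype.equivFin Ω ω : ℕ))
    fun i => (τ (Function.invFun (fun ω => (Fintype.equivFin Ω ω : ℕ)) i)).toAlgorithm,
    fun G => ?_⟩
  simp only [Algorithm.run, QueryTree.run_toAlgorithm]
  rw [PMF.bind_map]
  simp only [Function.comp_def, Function.leftInverse_invFun hinj _]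
  rfl

theorem clog_le_four_mul_log {n : ℕ} (h : 2 ≤ n) : (Nat.clog 2 n : ℝ) ≤ 4 * Real.log n := by
  have h2 : 1 / 2 < Real.log 2 := by linarith [Real.log_two_gt_d9]
  have hlog : Real.log 2 ≤ Real.log n := Real.log_le_log two_pos (by exact_mod_cast h)
  have hpow : 2 ^ (Nat.clog 2 n - 1) < n := Nat.pow_pred_clog_lt_self one_lt_two (by omega)
  have hpos : 0 < Nat.clog 2 n := Nat.clog_pos one_lt_two h
  have h₁ : ((Nat.clog 2 n - 1 : ℕ) : ℝ) * Real.log 2 ≤ Real.log n := by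
    rw [← Real.log_pow]
    exact Real.log_le_log (by positivity) (by exact_mod_cast hpow.le)
  rw [Nat.cast_sub hpos, Nat.cast_one] at h₁
  nlinarith

/-- One logarithm comes from the number `t` of trials, one from the budget for fibres times degree,
and one from binary search. -/
theorem cost_bound {n : ℕ} (h : 2 ≤ n) {t : ℕ} {D : ℝ} (ht : (t : ℝ) ≤ D * Real.log n)
    {l : ℕ} (hl : 0 < l) (hlog : (l : ℝ) ≤ 4 * Real.log n) :
    ((n + (t * (n * (3 + l * 3) + 2 * (192 * n * l + n) * (1 + 6 * l)) + (n + t)) : ℕ) : ℝ) ≤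
      (44000 * D + 16) * n * Real.log n ^ 3 := by
  have hn : (1 : ℝ) ≤ n := by exact_mod_cast (by omega : 1 ≤ n)
  have hl1 : (1 : ℝ) ≤ l := by exact_mod_cast hl
  have hlam : 1 / 2 ≤ Real.log n := by
    have : Real.log 2 ≤ Real.log n := Real.log_le_log two_pos (by exact_mod_cast h)
    linarith [Real.log_two_gt_d9]
  have ht0 : (0 : ℝ) ≤ t := Nat.cast_nonneg t
  generalize Real.log n = L at *
  have h₁ : (n * (3 + l * 3) + 2 * (192 * n * l + n) * (1 + 6 * l) : ℝ) ≤ n * (2708 * l ^ 2) := by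
    have e : (n * (3 + l * 3) + 2 * (192 * n * l + n) * (1 + 6 * l) : ℝ) =
      n * (5 + 399 * l + 2304 * l ^ 2) := by ring
    rw [e]
    gcongr
    nlinarith
  have h₂ : (t : ℝ) ≤ t * (n * l ^ 2) :=
    le_mul_of_one_le_right ht0 (one_le_mul_of_one_le_of_one_le hn (one_le_pow₀ hl1))
  have hDL : 0 ≤ D * L := ht0.trans ht
  have h₃ : (t * (n * l ^ 2) : ℝ) ≤ D * L * (n * (4 * L) ^ 2) := by gcongr
  have h₄ : (1 : ℝ) ≤ 8 * L ^ 3 := by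
    have : (1 / 2) ^ 3 ≤ L ^ 3 := by gcongr
    linarith
  have h₅ : (n : ℝ) ≤ n * (8 * L ^ 3) := le_mul_of_one_le_right (by linarith) h₄
  have h₆ : 0 ≤ t * (n * l ^ 2 : ℝ) := by positivity
  push_cast
  calc (n + (t * (n * (3 + l * 3) + 2 * (192 * n * l + n) * (1 + 6 * l)) + (n + t)) : ℝ)
      ≤ n * (8 * L ^ 3) + (t * (n * (2708 * l ^ 2)) + (n * (8 * L ^ 3) + t * (n * l ^ 2))) := by
        gcongr
    _ = 2709 * (t * (n * l ^ 2)) + 16 * n * L ^ 3 := by ring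
    _ ≤ 2750 * (D * L * (n * (4 * L) ^ 2)) + 16 * n * L ^ 3 := by linarith
    _ = _ := by ring

theorem one_sub_pow_mul_le {ε : ℝ} (hε : 0 < ε) (hε1 : ε ≤ 1) {n d t : ℕ} (hn : 0 < n)
    (ht : d * Real.log n / ε ≤ t) : (1 - ε) ^ t * (n : ℝ) ^ d ≤ 1 := by
  have hn' : (0 : ℝ) < n := by exact_mod_cast hn
  have h₁ : (1 - ε) ^ t ≤ Real.exp (-(d * Real.log n)) := by
    calc (1 - ε) ^ t ≤ Real.exp (-ε) ^ t := by
          refine pow_le_pow_left₀ (by linarith) ?_ t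
          linarith [Real.add_one_le_exp (-ε)]
      _ = Real.exp (t * -ε) := (Real.exp_nat_mul _ _).symm
      _ ≤ _ := by
          rw [div_le_iff₀ hε] at ht
          gcongr
          linarith
  have h₂ : (n : ℝ) ^ d = Real.exp (d * Real.log n) := by
    rw [Real.exp_nat_mul, Real.exp_log hn']
  calc (1 - ε) ^ t * (n : ℝ) ^ d ≤ Real.exp (-(d * Real.log n)) * Real.exp (d * Real.log n) := by
        rw [h₂]
        gcongr
    _ = 1 := by rw [← Real.exp_add, neg_add_cancel, Real.exp_zero]

open Classical in
/-- Independent repetition makes the failure probability small. -/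
theorem card_filter_forall_not_le {Ω : Type} [Fintype Ω] {ε : ℝ} (p : Ω → Prop)
    (hp : Fintype.card Ω * ε ≤ (Finset.univ.filter p).card) (t : ℕ) :
    ((Finset.univ.filter fun ω : Fin t → Ω => ∀ i, ¬ p (ω i)).card : ℝ) ≤
      (1 - ε) ^ t * Fintype.card (Fin t → Ω) := by
  have h : (Finset.univ.filter fun ω : Fin t → Ω => ∀ i, ¬ p (ω i)) =
      Fintype.piFinset fun _ => Finset.univ.filter fun a => ¬ p a := by
    ext ω
    simp [Fintype.mem_piFinset]
  have hsum := Finset.card_filter_add_card_filter_not (s := (Finset.univ : Finset Ω)) p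
  have hsum' : ((Finset.univ.filter p).card : ℝ) + (Finset.univ.filter fun a => ¬ p a).card =
      Fintype.card Ω := by
    rw [← Finset.card_univ]
    exact_mod_cast hsum
  rw [h, Fintype.card_piFinset_const, Fintype.card_pi_const]
  push_cast
  rw [← mul_pow]
  refine pow_le_pow_left₀ (Nat.cast_nonneg _) ?_ t
  linarith

theorem exists_algorithm_globalMinCut {n : ℕ} (h2 : 2 ≤ n) (d t : ℕ)
    (ht : d * Real.log n / (Real.exp (-64) / 4) ≤ t) :
    ∃ A : Algorithm (Fin n), ∀ G : SimpleGraph (Fin n),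
      (∀ r ∈ (A.run G).support, r.2 ≤ n + (t * (n * (3 + Nat.clog 2 n * 3) +
        2 * (192 * n * Nat.clog 2 n + n) * (1 + 6 * Nat.clog 2 n)) + (n + t))) ∧
      (A.run G).toOuterMeasure {r | ¬ IsGlobalMinCut G r.1} ≤ ((n : ℝ≥0∞) ^ d)⁻¹ := by
  classical
  have : NeZero n := ⟨by omega⟩
  have : Nontrivial (Fin n) := Fin.nontrivial_iff_two_le.mpr h2
  have hl : 0 < Nat.clog 2 n := Nat.clog_pos one_lt_two h2
  have hn : n ≤ 2 ^ Nat.clog 2 n := Nat.le_pow_clog one_lt_two n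
  generalize Nat.clog 2 n = l at *
  have : NeZero n.factorial := ⟨n.factorial_ne_zero⟩
  -- All moduli in use are between 1 and `n`, so they divide `n.factorial` and the reduced draws are
  -- exactly uniform.
  let Ω := (Fin n → Fin n.factorial) × (Fin n → Fin n.factorial)
  -- The raw draws do not depend on the graph. The least degree is learned later by queries and only
  -- decides how the draws are turned into centres.
  choose τ hτ using fun ω : Fin t → Ω => Solvable.globalMinCut h2 hn (192 * n * l)
    (fun d i => centers (sparsity l d) (ω i).1) fun i v => ((ω i).2 v : ℕ)
  obtain ⟨A, hA⟩ := exists_algorithm_uniform τ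
  refine ⟨A, fun G => ⟨fun r hr => ?_, ?_⟩⟩
  · rw [hA, PMF.mem_support_map_iff] at hr
    obtain ⟨ω, -, rfl⟩ := hr
    have := (hτ ω G).1
    rwa [Fintype.card_fin] at this
  · obtain ⟨T, hT⟩ := exists_isGlobalMinCut G
    have hbad : ((Finset.univ.filter fun ω => ¬ IsGlobalMinCut G ((τ ω).eval G)).card : ℝ) ≤
        (1 - Real.exp (-64) / 4) ^ t * Fintype.card (Fin t → Ω) := by
      have hε : Real.exp (-64) ≤ 1 := Real.exp_le_one_iff.mpr (by norm_num)
      by_cases hlt : cutValue G T < leastDegree G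
      · have hgood := le_card_filter_goodStars (N := n.factorial) hT hlt hl hn
          fun m hm hmn => Nat.dvd_factorial hm hmn
        refine (Nat.cast_le.mpr (Finset.card_le_card fun ω hω => ?_)).trans
          (card_filter_forall_not_le _ (ε := Real.exp (-64) / 4) (hgood.trans' (le_of_eq ?_)) t)
        · rw [Finset.mem_filter] at hω ⊢
          refine ⟨hω.1, fun i hi => hω.2 ((hτ ω G).2 T hT fun _ => ⟨i, hi⟩)⟩
        · rw [Fintype.card_prod, Fintype.card_pi_const, Fintype.card_fin]
          push_cast
          ring
      · rw [Finset.filter_false_of_mem fun ω _ =>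
          not_not.mpr ((hτ ω G).2 T hT fun h => absurd h hlt), Finset.card_empty, Nat.cast_zero]
        exact mul_nonneg (pow_nonneg (by linarith) t) (Nat.cast_nonneg _)
    have hbad' : (Finset.univ.filter fun ω => ¬ IsGlobalMinCut G ((τ ω).eval G)).card * n ^ d ≤
        Fintype.card (Fin t → Ω) := by
      have hε : Real.exp (-64) ≤ 1 := Real.exp_le_one_iff.mpr (by norm_num)
      have h₁ := one_sub_pow_mul_le (by positivity) (by linarith) (by omega : 0 < n) ht
      have h₂ : ((Finset.univ.filter fun ω => ¬ IsGlobalMinCut G ((τ ω).eval G)).card : ℝ) *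
          (n : ℝ) ^ d ≤ Fintype.card (Fin t → Ω) := by
        calc _ ≤ (1 - Real.exp (-64) / 4) ^ t * Fintype.card (Fin t → Ω) * (n : ℝ) ^ d := by gcongr
          _ = (1 - Real.exp (-64) / 4) ^ t * (n : ℝ) ^ d * Fintype.card (Fin t → Ω) := by ring
          _ ≤ 1 * Fintype.card (Fin t → Ω) := by gcongr
          _ = _ := one_mul _
      exact_mod_cast h₂
    rw [hA, PMF.toOuterMeasure_map_apply, PMF.toOuterMeasure_uniformOfFintype_apply]
    refine ENNReal.div_le_of_le_mul ?_
    rw [mul_comm, ← div_eq_mul_inv, ENNReal.le_div_iff_mul_le (Or.inl (by simp; omega))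
      (Or.inl (by simp))]
    have hcard : Fintype.card ((fun ω => ((τ ω).eval G, (τ ω).cost G)) ⁻¹'
        {r : Finset (Fin n) × ℕ | ¬ IsGlobalMinCut G r.1}) =
        (Finset.univ.filter fun ω => ¬ IsGlobalMinCut G ((τ ω).eval G)).card := by
      rw [← Set.toFinset_card]
      congr 1
      ext ω
      simp
    rw [hcard]
    exact_mod_cast hbad'

end Assembly

end CutQuery

theorem theorem1 :
    ∃ k : ℕ, ∀ d : ℕ, ∃ C : ℝ, ∃ A : (n : ℕ) → CutQuery.Algorithm (Fin n),
      ∀ n : ℕ, 2 ≤ n → ∀ G : SimpleGraph (Fin n),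
        (∀ r ∈ ((A n).run G).support, (r.2 : ℝ) ≤ C * n * Real.log n ^ k) ∧
        ((A n).run G).toOuterMeasure {r | ¬ CutQuery.IsGlobalMinCut G r.1} ≤
          ((n : ℝ≥0∞) ^ d)⁻¹ := by
  refine ⟨3, fun d => ?_⟩
  -- The summand 2 absorbs the rounding up of the number of trials, since `Real.log n ≥ 1 / 2`.
  let D : ℝ := d / (Real.exp (-64) / 4) + 2
  have h : ∀ n : ℕ, ∃ A : CutQuery.Algorithm (Fin n), 2 ≤ n → ∀ G : SimpleGraph (Fin n),
      (∀ r ∈ (A.run G).support, (r.2 : ℝ) ≤ (44000 * D + 16) * n * Real.log n ^ 3) ∧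
      (A.run G).toOuterMeasure {r | ¬ CutQuery.IsGlobalMinCut G r.1} ≤ ((n : ℝ≥0∞) ^ d)⁻¹ := by
    intro n
    by_cases hn : 2 ≤ n
    · obtain ⟨A, hA⟩ := CutQuery.exists_algorithm_globalMinCut hn d
        ⌈d * Real.log n / (Real.exp (-64) / 4)⌉₊ (Nat.le_ceil _)
      refine ⟨A, fun _ G => ⟨fun r hr => ?_, (hA G).2⟩⟩
      have hlog : 1 / 2 ≤ Real.log n := by
        have : Real.log 2 ≤ Real.log n := Real.log_le_log two_pos (by exact_mod_cast hn)
        linarith [Real.log_two_gt_d9]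
      have ht : (⌈d * Real.log n / (Real.exp (-64) / 4)⌉₊ : ℝ) ≤ D * Real.log n := by
        have hceil := Nat.ceil_lt_add_one
          (by positivity : 0 ≤ d * Real.log n / (Real.exp (-64) / 4))
        have e : D * Real.log n = d * Real.log n / (Real.exp (-64) / 4) + 2 * Real.log n := by
          simp only [D]
          ring
        rw [e]
        linarith
      exact (Nat.cast_le.mpr ((hA G).1 r hr)).trans (CutQuery.cost_bound hn ht
        (Nat.clog_pos one_lt_two hn) (CutQuery.clog_le_four_mul_log hn))
    · exact ⟨.output ∅, fun h => absurd h hn⟩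
  choose A hA using h
  exact ⟨44000 * D + 16, A, hA⟩
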